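/- Let $\mathbb A$ be an abelian category with enough projective objects. Let $\mathbb A^{[1]}$ be the 2-category whose objects are the arrows $a:A_1\to A_0$ of $\mathbb A$, whose morphisms $a\to b$ are the commutative squares $(f_1:A_1\to B_1,\ f_0:A_0\to B_0)$, $b f_1=f_0 a$, and whose 2-arrows $(f_1,f_0)\Rightarrow(g_1,g_0)$ are the morphisms $h:A_0\to B_1$ of $\mathbb A$ with $f_1-g_1=ha$ and $f_0-g_0=bh$ (composed by addition). Let $\mathbb A^{[1]}_c$ be its full sub-2-category on the objects $a:A_1\to A_0$ with $A_0$ projective. Then: (1) $\mathbb A^{[1]}_c$ is a 2-abelian $\mathsf{Gpd}$-category, that is: * all its 2-arrows are invertible, it has a zero object $0$ (so that there are zero arrows $X\to 0\to Y$, and canonical 2-arrows between a composite of a zero arrow with any arrow and the zero arrow), and it is additive: any two objects have a biproduct (a product and a coproduct in the 2-categorical sense, with compatible projections and injections), and for every object $A$ there is $n:A\to A$ such that $A\xrightarrow{(1,n)}A\oplus A\xrightarrow{(1,1)}A$ is isomorphic to a zero arrow; * every arrow $f:A\to B$ has a 2-kernel $(K,\ k:K\to A,\ \kappa:fk\Rightarrow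 0)$ ($\mathrm{Hom}(X,K)$ is equivalent, through $(k,\kappa)$, to the groupoid of pairs $(x:X\to A,\ \varphi:fx\Rightarrow 0)$, for every $X$) and, dually, a 2-cokernel; * every arrow $f:A\to B$ has a pip, i.e. an object $\mathrm{Pip} f$ with a 2-arrow $\pi_f:0\Rightarrow 0:\mathrm{Pip} f\to A$ with $f\pi_f=1$ such that, for every $X$, $\mathrm{Hom}(X,\mathrm{Pip} f)$ is equivalent, through $\pi_f$, to the set (discrete groupoid) of 2-arrows $\sigma:0\Rightarrow0:X\to A$ with $f\sigma=1$; and, dually, a copip $\rho_f:0\Rightarrow 0:B\to\mathrm{Copip} f$; * every 2-arrow $\rho:0\Rightarrow 0:A\to B$ has a root, i.e. an arrow $r:\mathrm{Root}\,\rho\to A$ with $\rho r=1$ such that, for every $X$, $\mathrm{Hom}(X,\mathrm{Root}\,\rho)$ is equivalent, through $r$, to the full subgroupoid of $\mathrm{Hom}(X,A)$ on the $x$ with $\rho x=1$; and, dually, a coroot $B\to\mathrm{Coroot}\,\rho$; * for every arrow $f$, the two canonical comparison arrows $$\mathrm{Coroot}(\pi_f)\to\mathrm{Ker}(\mathrm{Coker}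 f),\qquad \mathrm{Coker}(\mathrm{Ker} f)\to\mathrm{Root}(\rho_f)$$ (with 2-kernels and 2-cokernels), determined by the requirement that they factor $f$ compatibly with the structural 2-arrows, are equivalences. (2) Call an object $a$ of $\mathbb A^{[1]}_c$ discrete if $a\to 0$ is faithful (that is, $\mathrm{Hom}(X,a)\to\mathrm{Hom}(X,0)$ is a faithful functor for every $X$) and codiscrete if $0\to a$ is cofaithful (that is, $\mathrm{Hom}(a,Y)\to\mathrm{Hom}(0,Y)$ is a faithful functor for every $Y$). The full sub-2-category of $\mathbb A^{[1]}_c$ on the discrete objects, and the full sub-2-category on the codiscrete objects, are each equivalent to the category $\mathbb A$, regarded as a 2-category with only identity 2-arrows. -/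

import Mathlib

open CategoryTheory CategoryTheory.Limits CategoryTheory.Bicategory

universe w v u

/-! ## Notions for groupoid enriched categories

A Gpd-category is a bicategory all of whose 2-arrows are invertible (`IsLocallyGroupoid`).
Composition is written in diagrammatic order: `f ≫ g` is `f` followed by `g`. -/

namespace GpdCat

section

variable {C : Type u} [Bicategory.{w, v} C]

/-- The arrow `f` is faithful: postcomposition with `f` is a faithful functor
`Hom(X, a) → Hom(X, b)` for every `X`. -/
def IsFaithful {a b : C} (f : a ⟶ b) : Prop :=
  ∀ ⦃X : C⦄ ⦃x y : X ⟶ a⦄ (σ τ : x ⟶ y), σ ▷ f = τ ▷ f → σ = τ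

/-- The arrow `f` is cofaithful: precomposition with `f` is a faithful functor
`Hom(b, Y) → Hom(a, Y)` for every `Y`. -/
def IsCofaithful {a b : C} (f : a ⟶ b) : Prop :=
  ∀ ⦃Y : C⦄ ⦃x y : b ⟶ Y⦄ (σ τ : x ⟶ y), f ◁ σ = f ◁ τ → σ = τ

/-- The arrow `f` is an equivalence (invertible up to invertible 2-arrows). -/
def IsEquivalenceArrow {a b : C} (f : a ⟶ b) : Prop :=
  ∃ g : b ⟶ a, Nonempty (f ≫ g ≅ 𝟙 a) ∧ Nonempty (g ≫ f ≅ 𝟙 b)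

end

/-- A zero object: all the categories `Hom(X, 0)` and `Hom(0, X)` are equivalent to the
one-arrow category, i.e. they are inhabited, and there is exactly one 2-arrow between any two of
their objects. -/
structure ZeroObject (C : Type u) [Bicategory.{w, v} C] where
  /-- the zero object itself -/
  obj : C
  /-- an arrow to the zero object -/
  toZ : ∀ X : C, X ⟶ obj
  /-- an arrow from the zero object -/
  fromZ : ∀ X : C, obj ⟶ X
  /-- the 2-arrow between two arrows to the zero object -/
  toHom : ∀ {X : C} (f g : X ⟶ obj), f ⟶ g
  /-- the 2-arrow between two arrows from the zero object -/
  fromHom : ∀ {X : C} (f g : obj ⟶ X), f ⟶ g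
  to_ext : ∀ {X : C} {f g : X ⟶ obj} (σ τ : f ⟶ g), σ = τ
  from_ext : ∀ {X : C} {f g : obj ⟶ X} (σ τ : f ⟶ g), σ = τ

namespace ZeroObject

variable {C : Type u} [Bicategory.{w, v} C] (Z : ZeroObject C)

/-- The zero arrow `X → 0 → Y`. -/
def zero (X Y : C) : X ⟶ Y := Z.toZ X ≫ Z.fromZ Y

/-- The canonical 2-arrow from (`f` followed by zero) to zero. -/
def compZero {X Y : C} (f : X ⟶ Y) (W : C) : f ≫ Z.zero Y W ⟶ Z.zero X W :=
  (α_ f (Z.toZ Y) (Z.fromZ W)).inv ≫ Z.toHom (f ≫ Z.toZ Y) (Z.toZ X) ▷ Z.fromZ W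

/-- The canonical 2-arrow from (zero followed by `f`) to zero. -/
def zeroComp (W : C) {X Y : C} (f : X ⟶ Y) : Z.zero W X ≫ f ⟶ Z.zero W Y :=
  (α_ (Z.toZ W) (Z.fromZ X) f).hom ≫ Z.toZ W ◁ Z.fromHom (Z.fromZ X ≫ f) (Z.fromZ Y)

/-- `(K, k, κ)` is a 2-kernel of `f`: for every `X`, the functor from `Hom(X, K)` to the groupoid
of pairs `(x : X → A, φ : x ≫ f ⇒ 0)` is essentially surjective, full and faithful. -/
structure IsKernel {K A B : C} (f : A ⟶ B) (k : K ⟶ A) (κ : k ≫ f ⟶ Z.zero K B) : Prop where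
  exists_lift : ∀ {X : C} (x : X ⟶ A) (φ : x ≫ f ⟶ Z.zero X B),
    ∃ (x' : X ⟶ K) (χ : x' ≫ k ≅ x),
      χ.hom ▷ f ≫ φ = (α_ x' k f).hom ≫ x' ◁ κ ≫ Z.compZero x' B
  existsUnique_lift₂ : ∀ {X : C} (x y : X ⟶ K) (χ : x ≫ k ⟶ y ≫ k),
    χ ▷ f ≫ (α_ y k f).hom ≫ y ◁ κ ≫ Z.compZero y B =
      (α_ x k f).hom ≫ x ◁ κ ≫ Z.compZero x B →
    ∃! ξ : x ⟶ y, ξ ▷ k = χ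

/-- `(Q, q, ξ)` is a 2-cokernel of `f` (the dual notion). -/
structure IsCokernel {A B Q : C} (f : A ⟶ B) (q : B ⟶ Q) (ξ : f ≫ q ⟶ Z.zero A Q) : Prop where
  exists_desc : ∀ {Y : C} (y : B ⟶ Y) (φ : f ≫ y ⟶ Z.zero A Y),
    ∃ (y' : Q ⟶ Y) (χ : q ≫ y' ≅ y),
      f ◁ χ.hom ≫ φ = (α_ f q y').inv ≫ ξ ▷ y' ≫ Z.zeroComp A y'
  existsUnique_desc₂ : ∀ {Y : C} (x y : Q ⟶ Y) (χ : q ≫ x ⟶ q ≫ y),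
    f ◁ χ ≫ (α_ f q y).inv ≫ ξ ▷ y ≫ Z.zeroComp A y =
      (α_ f q x).inv ≫ ξ ▷ x ≫ Z.zeroComp A x →
    ∃! ζ : x ⟶ y, q ◁ ζ = χ

/-- `(P, π)` is a pip of `f : A → B`: `π : 0 ⇒ 0 : P → A` is a loop killed by `f`, and for every
`X` composition with `π` is an equivalence from `Hom(X, P)` to the set (discrete groupoid) of
loops `0 ⇒ 0 : X → A` killed by `f`. -/
structure IsPip {P A B : C} (f : A ⟶ B) (π : Z.zero P A ⟶ Z.zero P A) : Prop where
  condition : π ▷ f = 𝟙 (Z.zero P A ≫ f)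
  exists_lift : ∀ {X : C} (σ : Z.zero X A ⟶ Z.zero X A), σ ▷ f = 𝟙 (Z.zero X A ≫ f) →
    ∃ x : X ⟶ P, x ◁ π ≫ Z.compZero x A = Z.compZero x A ≫ σ
  unique_lift₂ : ∀ {X : C} (σ : Z.zero X A ⟶ Z.zero X A) (x y : X ⟶ P),
    x ◁ π ≫ Z.compZero x A = Z.compZero x A ≫ σ →
    y ◁ π ≫ Z.compZero y A = Z.compZero y A ≫ σ →
    Nonempty (Unique (x ⟶ y))

/-- `(R, ρ)` is a copip of `f : A → B` (the dual notion): a universal loop `ρ : 0 ⇒ 0 : B → R`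
killed by precomposition with `f`. -/
structure IsCopip {A B R : C} (f : A ⟶ B) (ρ : Z.zero B R ⟶ Z.zero B R) : Prop where
  condition : f ◁ ρ = 𝟙 (f ≫ Z.zero B R)
  exists_desc : ∀ {Y : C} (σ : Z.zero B Y ⟶ Z.zero B Y), f ◁ σ = 𝟙 (f ≫ Z.zero B Y) →
    ∃ y : R ⟶ Y, ρ ▷ y ≫ Z.zeroComp B y = Z.zeroComp B y ≫ σ
  unique_desc₂ : ∀ {Y : C} (σ : Z.zero B Y ⟶ Z.zero B Y) (x y : R ⟶ Y),
    ρ ▷ x ≫ Z.zeroComp B x = Z.zeroComp B x ≫ σ →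
    ρ ▷ y ≫ Z.zeroComp B y = Z.zeroComp B y ≫ σ →
    Nonempty (Unique (x ⟶ y))

/-- `r : R → A` is a root of the loop `ρ : 0 ⇒ 0 : A → B`: for every `X`, composition with `r` is
an equivalence from `Hom(X, R)` to the full subgroupoid of `Hom(X, A)` of the arrows killing
`ρ`. -/
structure IsRoot {R A B : C} (ρ : Z.zero A B ⟶ Z.zero A B) (r : R ⟶ A) : Prop where
  condition : r ◁ ρ = 𝟙 (r ≫ Z.zero A B)
  exists_lift : ∀ {X : C} (x : X ⟶ A), x ◁ ρ = 𝟙 (x ≫ Z.zero A B) →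
    ∃ x' : X ⟶ R, Nonempty (x' ≫ r ≅ x)
  existsUnique_lift₂ : ∀ {X : C} (x y : X ⟶ R) (χ : x ≫ r ⟶ y ≫ r), ∃! ξ : x ⟶ y, ξ ▷ r = χ

/-- `c : B → Q` is a coroot of the loop `π : 0 ⇒ 0 : A → B` (the dual notion). -/
structure IsCoroot {A B Q : C} (π : Z.zero A B ⟶ Z.zero A B) (c : B ⟶ Q) : Prop where
  condition : π ▷ c = 𝟙 (Z.zero A B ≫ c)
  exists_desc : ∀ {Y : C} (y : B ⟶ Y), π ▷ y = 𝟙 (Z.zero A B ≫ y) →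
    ∃ y' : Q ⟶ Y, Nonempty (c ≫ y' ≅ y)
  existsUnique_desc₂ : ∀ {Y : C} (x y : Q ⟶ Y) (χ : c ≫ x ⟶ c ≫ y), ∃! ζ : x ⟶ y, c ◁ ζ = χ

/-- `P` with projections `p₁, p₂` is a product of `A` and `B`. -/
structure IsProduct {P A B : C} (p₁ : P ⟶ A) (p₂ : P ⟶ B) : Prop where
  exists_lift : ∀ {X : C} (x₁ : X ⟶ A) (x₂ : X ⟶ B),
    ∃ x : X ⟶ P, Nonempty (x ≫ p₁ ≅ x₁) ∧ Nonempty (x ≫ p₂ ≅ x₂)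
  existsUnique_lift₂ : ∀ {X : C} (x y : X ⟶ P) (σ₁ : x ≫ p₁ ⟶ y ≫ p₁) (σ₂ : x ≫ p₂ ⟶ y ≫ p₂),
    ∃! σ : x ⟶ y, σ ▷ p₁ = σ₁ ∧ σ ▷ p₂ = σ₂

/-- `P` with injections `i₁, i₂` is a coproduct of `A` and `B`. -/
structure IsCoproduct {P A B : C} (i₁ : A ⟶ P) (i₂ : B ⟶ P) : Prop where
  exists_desc : ∀ {Y : C} (y₁ : A ⟶ Y) (y₂ : B ⟶ Y),
    ∃ y : P ⟶ Y, Nonempty (i₁ ≫ y ≅ y₁) ∧ Nonempty (i₂ ≫ y ≅ y₂)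
  existsUnique_desc₂ : ∀ {Y : C} (x y : P ⟶ Y) (σ₁ : i₁ ≫ x ⟶ i₁ ≫ y) (σ₂ : i₂ ≫ x ⟶ i₂ ≫ y),
    ∃! σ : x ⟶ y, i₁ ◁ σ = σ₁ ∧ i₂ ◁ σ = σ₂

/-- `P` is a biproduct of `A` and `B`. -/
structure IsBiproduct {P A B : C} (p₁ : P ⟶ A) (p₂ : P ⟶ B) (i₁ : A ⟶ P) (i₂ : B ⟶ P) :
    Prop where
  isProduct : IsProduct p₁ p₂
  isCoproduct : IsCoproduct i₁ i₂
  inl_fst : Nonempty (i₁ ≫ p₁ ≅ 𝟙 A)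
  inl_snd : Nonempty (i₁ ≫ p₂ ≅ Z.zero A B)
  inr_fst : Nonempty (i₂ ≫ p₁ ≅ Z.zero B A)
  inr_snd : Nonempty (i₂ ≫ p₂ ≅ 𝟙 B)

/-- Additivity: all binary biproducts exist, and the addition that they induce on the
hom-groupoids has negatives (so that the hom-groupoids are Picard categories): for every `A` there
are `n : A → A` and `d = (1, n) : A → A ⊕ A` such that `d` followed by the codiagonal `s` is
isomorphic to zero. -/
structure IsAdditive : Prop where
  exists_biproduct : ∀ A B : C, ∃ (P : C) (p₁ : P ⟶ A) (p₂ : P ⟶ B) (i₁ : A ⟶ P) (i₂ : B ⟶ P),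
    Z.IsBiproduct p₁ p₂ i₁ i₂
  exists_neg : ∀ {A P : C} (p₁ p₂ : P ⟶ A) (i₁ i₂ : A ⟶ P), Z.IsBiproduct p₁ p₂ i₁ i₂ →
    ∃ (n : A ⟶ A) (d : A ⟶ P) (s : P ⟶ A),
      Nonempty (d ≫ p₁ ≅ 𝟙 A) ∧ Nonempty (d ≫ p₂ ≅ n) ∧
      Nonempty (i₁ ≫ s ≅ 𝟙 A) ∧ Nonempty (i₂ ≫ s ≅ 𝟙 A) ∧ Nonempty (d ≫ s ≅ Z.zero A A)

/-- Let `c : A → M` be the coroot of the pip of `f : A → B`, let `(Q, q, ξ)` be the 2-cokernel of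
`f` and `(K, k, κ)` the 2-kernel of `q`. The arrow `w : M → K` is a comparison arrow if `c`, `w`
and `k` compose to `f` up to a 2-arrow which identifies the 2-arrow induced by `κ` with `ξ`. -/
def IsCorootComparison {A B Q K M : C} (f : A ⟶ B)
    {q : B ⟶ Q} (ξ : f ≫ q ⟶ Z.zero A Q) {k : K ⟶ B} (κ : k ≫ q ⟶ Z.zero K Q)
    (c : A ⟶ M) (w : M ⟶ K) : Prop :=
  ∃ θ : c ≫ w ≫ k ≅ f,
    θ.hom ▷ q ≫ ξ =
      (α_ c (w ≫ k) q).hom ≫ c ◁ ((α_ w k q).hom ≫ w ◁ κ ≫ Z.compZero w Q) ≫ Z.compZero c Q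

/-- Let `(K, k, κ)` be the 2-kernel of `f : A → B`, let `(Q, q, ξ)` be the 2-cokernel of `k`, and
let `r : M → B` be the root of the copip of `f`. The arrow `w : Q → M` is a comparison arrow if
`q`, `w` and `r` compose to `f` up to a 2-arrow which identifies the 2-arrow induced by `ξ`
with `κ`. -/
def IsRootComparison {K A B Q M : C} (f : A ⟶ B)
    {k : K ⟶ A} (κ : k ≫ f ⟶ Z.zero K B) {q : A ⟶ Q} (ξ : k ≫ q ⟶ Z.zero K Q)
    (r : M ⟶ B) (w : Q ⟶ M) : Prop :=
  ∃ θ : (q ≫ w) ≫ r ≅ f,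
    k ◁ θ.hom ≫ κ =
      (α_ k (q ≫ w) r).inv ≫ ((α_ k q w).inv ≫ ξ ▷ w ≫ Z.zeroComp K w) ▷ r ≫ Z.zeroComp K r

/-- 2-Puppe-exactness: 2-kernels, 2-cokernels, pips, copips, roots and coroots exist, and for every
arrow `f` the two canonical comparison arrows
`Coroot (Pip f) → Ker (Coker f)` and `Coker (Ker f) → Root (Copip f)`
exist and are equivalences. -/
structure IsTwoPuppeExact : Prop where
  exists_kernel : ∀ {A B : C} (f : A ⟶ B),
    ∃ (K : C) (k : K ⟶ A) (κ : k ≫ f ⟶ Z.zero K B), Z.IsKernel f k κ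
  exists_cokernel : ∀ {A B : C} (f : A ⟶ B),
    ∃ (Q : C) (q : B ⟶ Q) (ξ : f ≫ q ⟶ Z.zero A Q), Z.IsCokernel f q ξ
  exists_pip : ∀ {A B : C} (f : A ⟶ B), ∃ (P : C) (π : Z.zero P A ⟶ Z.zero P A), Z.IsPip f π
  exists_copip : ∀ {A B : C} (f : A ⟶ B), ∃ (R : C) (ρ : Z.zero B R ⟶ Z.zero B R), Z.IsCopip f ρ
  exists_root : ∀ {A B : C} (ρ : Z.zero A B ⟶ Z.zero A B), ∃ (R : C) (r : R ⟶ A), Z.IsRoot ρ r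
  exists_coroot : ∀ {A B : C} (π : Z.zero A B ⟶ Z.zero A B),
    ∃ (Q : C) (c : B ⟶ Q), Z.IsCoroot π c
  coroot_comparison : ∀ {A B P M Q K : C} (f : A ⟶ B)
    (π : Z.zero P A ⟶ Z.zero P A) (c : A ⟶ M)
    (q : B ⟶ Q) (ξ : f ≫ q ⟶ Z.zero A Q) (k : K ⟶ B) (κ : k ≫ q ⟶ Z.zero K Q),
    Z.IsPip f π → Z.IsCoroot π c → Z.IsCokernel f q ξ → Z.IsKernel q k κ →
    (∃ w : M ⟶ K, Z.IsCorootComparison f ξ κ c w) ∧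
      ∀ w : M ⟶ K, Z.IsCorootComparison f ξ κ c w → IsEquivalenceArrow w
  root_comparison : ∀ {A B R M Q K : C} (f : A ⟶ B)
    (ρ : Z.zero B R ⟶ Z.zero B R) (r : M ⟶ B)
    (k : K ⟶ A) (κ : k ≫ f ⟶ Z.zero K B) (q : A ⟶ Q) (ξ : k ≫ q ⟶ Z.zero K Q),
    Z.IsCopip f ρ → Z.IsRoot ρ r → Z.IsKernel f k κ → Z.IsCokernel k q ξ →
    (∃ w : Q ⟶ M, Z.IsRootComparison f κ ξ r w) ∧
      ∀ w : Q ⟶ M, Z.IsRootComparison f κ ξ r w → IsEquivalenceArrow w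

end ZeroObject

/-- A 2-abelian Gpd-category: all 2-arrows are invertible, and there is a zero object with respect
to which it is additive and 2-Puppe-exact. (Zero objects are unique up to an essentially unique
equivalence, so the choice does not matter.) -/
structure IsTwoAbelian (C : Type u) [Bicategory.{w, v} C] : Prop where
  isLocallyGroupoid : IsLocallyGroupoid C
  exists_zero : ∃ Z : ZeroObject C, Z.IsAdditive ∧ Z.IsTwoPuppeExact

section

variable {C : Type u} [Bicategory.{w, v} C]

/-- An object `a` is discrete if `a → 0` is faithful. -/
def IsDiscreteObj (a : C) : Prop := ∃ Z : ZeroObject C, IsFaithful (Z.toZ a)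

/-- An object `a` is codiscrete (connected) if `0 → a` is cofaithful. -/
def IsCodiscreteObj (a : C) : Prop := ∃ Z : ZeroObject C, IsCofaithful (Z.fromZ a)

/-- The full sub-2-category of the objects satisfying `P`. -/
abbrev FullSub (P : C → Prop) : Type u :=
  InducedBicategory C (Subtype.val : {a : C // P a} → C)

end

/-- The bicategory `C` is equivalent to the category `A` (regarded as a bicategory with only
identity 2-arrows): there is a pseudofunctor which is surjective on objects up to equivalence and
an equivalence on hom-categories. -/
def EquivalentToCategory (C : Type u) [Bicategory.{w, v} C] (A : Type*) [Category A] : Prop :=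
  ∃ F : Pseudofunctor C (LocallyDiscrete A),
    (∀ X : LocallyDiscrete A, ∃ (a : C) (e : F.obj a ⟶ X), IsEquivalenceArrow e) ∧
    ∀ a b : C, (F.mapFunctor a b).IsEquivalence

end GpdCat

/-! ## The 2-category of arrows of an abelian category -/

/-- An object of the 2-category of arrows: an arrow `d : A₁ → A₀` of `A`. -/
structure ArrowObj (A : Type u) [Category.{v} A] where
  /-- source -/
  X₁ : A
  /-- target -/
  X₀ : A
  /-- the arrow -/
  d : X₁ ⟶ X₀

namespace ArrowObj

variable {A : Type u} [Category.{v} A]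

/-- A morphism of arrows: a commutative square. -/
@[ext]
structure Hom (a b : ArrowObj A) where
  /-- component on sources -/
  f₁ : a.X₁ ⟶ b.X₁
  /-- component on targets -/
  f₀ : a.X₀ ⟶ b.X₀
  comm : f₁ ≫ b.d = a.d ≫ f₀

instance : CategoryStruct (ArrowObj A) where
  Hom := Hom
  id a := { f₁ := 𝟙 _, f₀ := 𝟙 _, comm := by simp }
  comp f g :=
    { f₁ := f.f₁ ≫ g.f₁
      f₀ := f.f₀ ≫ g.f₀
      comm := by rw [Category.assoc, g.comm, ← Category.assoc, f.comm, Category.assoc] }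

@[ext]
theorem hom_ext {a b : ArrowObj A} {f g : a ⟶ b} (h₁ : f.f₁ = g.f₁) (h₀ : f.f₀ = g.f₀) : f = g :=
  Hom.ext h₁ h₀

@[simp] theorem id_f₁ (a : ArrowObj A) : (𝟙 a : a ⟶ a).f₁ = 𝟙 a.X₁ := rfl

@[simp] theorem id_f₀ (a : ArrowObj A) : (𝟙 a : a ⟶ a).f₀ = 𝟙 a.X₀ := rfl

@[simp] theorem comp_f₁ {a b c : ArrowObj A} (f : a ⟶ b) (g : b ⟶ c) :
    (f ≫ g).f₁ = f.f₁ ≫ g.f₁ := rfl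

@[simp] theorem comp_f₀ {a b c : ArrowObj A} (f : a ⟶ b) (g : b ⟶ c) :
    (f ≫ g).f₀ = f.f₀ ≫ g.f₀ := rfl

theorem assoc_eq {a b c e : ArrowObj A} (f : a ⟶ b) (g : b ⟶ c) (k : c ⟶ e) :
    (f ≫ g) ≫ k = f ≫ g ≫ k := by ext <;> simp

theorem id_comp_eq {a b : ArrowObj A} (f : a ⟶ b) : 𝟙 a ≫ f = f := by ext <;> simp

theorem comp_id_eq {a b : ArrowObj A} (f : a ⟶ b) : f ≫ 𝟙 b = f := by ext <;> simp

variable [Preadditive A]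

/-- A 2-arrow `f ⇒ g` between morphisms `a → b` of arrows: a homotopy `h : A₀ → B₁`. -/
@[ext]
structure Hom₂ {a b : ArrowObj A} (f g : a ⟶ b) where
  /-- the homotopy -/
  h : a.X₀ ⟶ b.X₁
  w₁ : f.f₁ - g.f₁ = a.d ≫ h
  w₀ : f.f₀ - g.f₀ = h ≫ b.d

instance (a b : ArrowObj A) : Category (a ⟶ b) where
  Hom := Hom₂
  id f := { h := 0, w₁ := by simp, w₀ := by simp }
  comp σ τ :=
    { h := σ.h + τ.h
      w₁ := by rw [Preadditive.comp_add, ← σ.w₁, ← τ.w₁]; abel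
      w₀ := by rw [Preadditive.add_comp, ← σ.w₀, ← τ.w₀]; abel }
  id_comp σ := Hom₂.ext (zero_add _)
  comp_id σ := Hom₂.ext (add_zero _)
  assoc σ τ υ := Hom₂.ext (add_assoc _ _ _)

@[ext]
theorem hom₂_ext {a b : ArrowObj A} {f g : a ⟶ b} {σ τ : f ⟶ g} (h : σ.h = τ.h) : σ = τ :=
  Hom₂.ext h

@[simp] theorem id_h {a b : ArrowObj A} (f : a ⟶ b) : (𝟙 f : f ⟶ f).h = 0 := rfl

@[simp] theorem comp_h {a b : ArrowObj A} {f g k : a ⟶ b} (σ : f ⟶ g) (τ : g ⟶ k) :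
    (σ ≫ τ).h = σ.h + τ.h := rfl

/-- Equal morphisms are isomorphic through the zero homotopy. -/
@[simps]
def isoOfEq {a b : ArrowObj A} {f g : a ⟶ b} (e : f = g) : f ≅ g where
  hom := { h := 0, w₁ := by simp [e], w₀ := by simp [e] }
  inv := { h := 0, w₁ := by simp [e], w₀ := by simp [e] }
  hom_inv_id := by ext; simp
  inv_hom_id := by ext; simp

/-- Whiskering of a homotopy by a preceding morphism. -/
@[simps]
def whiskerL {a b c : ArrowObj A} (f : a ⟶ b) {g k : b ⟶ c} (σ : Hom₂ g k) :
    Hom₂ (f ≫ g) (f ≫ k) where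
  h := f.f₀ ≫ σ.h
  w₁ := by
    rw [comp_f₁, comp_f₁, ← Preadditive.comp_sub, σ.w₁, ← Category.assoc, f.comm, Category.assoc]
  w₀ := by rw [comp_f₀, comp_f₀, ← Preadditive.comp_sub, σ.w₀, Category.assoc]

/-- Whiskering of a homotopy by a following morphism. -/
@[simps]
def whiskerR {a b c : ArrowObj A} {f g : a ⟶ b} (σ : Hom₂ f g) (k : b ⟶ c) :
    Hom₂ (f ≫ k) (g ≫ k) where
  h := σ.h ≫ k.f₁
  w₁ := by rw [comp_f₁, comp_f₁, ← Preadditive.sub_comp, σ.w₁, Category.assoc]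
  w₀ := by
    rw [comp_f₀, comp_f₀, ← Preadditive.sub_comp, σ.w₀, Category.assoc, Category.assoc, k.comm]

/-- The 2-category of arrows of `A`. -/
instance : Bicategory (ArrowObj A) where
  whiskerLeft f _ _ σ := whiskerL f σ
  whiskerRight σ k := whiskerR σ k
  associator f g k := isoOfEq (assoc_eq f g k)
  leftUnitor f := isoOfEq (id_comp_eq f)
  rightUnitor f := isoOfEq (comp_id_eq f)
  whiskerLeft_id _ _ := by ext; simp
  whiskerLeft_comp _ _ _ _ _ _ := by ext; simp
  id_whiskerLeft _ := by ext; simp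
  comp_whiskerLeft _ _ _ _ _ := by ext; simp
  id_whiskerRight _ _ := by ext; simp
  comp_whiskerRight _ _ _ := by ext; simp
  whiskerRight_id _ := by ext; simp
  whiskerRight_comp _ _ _ := by ext; simp
  whisker_assoc _ _ _ _ _ := by ext; simp
  whisker_exchange {_ _ _ f g k l} σ τ := by
    have h₀ := sub_eq_iff_eq_add.1 σ.w₀
    have h₁ := sub_eq_iff_eq_add.1 τ.w₁
    ext
    simp [h₀, h₁]
    abel
  pentagon _ _ _ _ := by ext; simp
  triangle _ _ := by ext; simp

@[simp] theorem whiskerLeft_h {a b c : ArrowObj A} (f : a ⟶ b) {g k : b ⟶ c} (σ : g ⟶ k) :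
    (f ◁ σ).h = f.f₀ ≫ σ.h := rfl

@[simp] theorem whiskerRight_h {a b c : ArrowObj A} {f g : a ⟶ b} (σ : f ⟶ g) (k : b ⟶ c) :
    (σ ▷ k).h = σ.h ≫ k.f₁ := rfl

theorem isoOfEq_eq_eqToIso {a b : ArrowObj A} {f g : a ⟶ b} (e : f = g) :
    isoOfEq e = eqToIso e := by
  subst e
  ext
  rfl

/-- Composition of morphisms is strictly associative and unital. -/
instance : Bicategory.Strict (ArrowObj A) where
  id_comp := id_comp_eq
  comp_id := comp_id_eq
  assoc := assoc_eq
  leftUnitor_eqToIso _ := isoOfEq_eq_eqToIso _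
  rightUnitor_eqToIso _ := isoOfEq_eq_eqToIso _
  associator_eqToIso _ _ _ := isoOfEq_eq_eqToIso _

end ArrowObj

/-- The full sub-2-category of the 2-category of arrows of `A` on the arrows `A₁ → A₀` with `A₀`
projective. -/
abbrev ProjArrow (A : Type u) [Category.{v} A] [Preadditive A] : Type (max u v) :=
  GpdCat.FullSub (fun a : ArrowObj A => Projective a.X₀)

-- An object is a two-term complex with projective lower term, and each universal object is a limit
-- or colimit in `A`, corrected so that the lower term stays projective. Colimits need no
-- correction: the 2-cokernel of `f` is the pushout of `f₁ f` and `d X` over the unchanged `tgt Y`,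
-- a coroot divides the source by the image of the loop, and a copip has lower term 0. For limits,
-- the homotopy pullback `L` of `f₀ f` and `d Y` classifies arrows with a null-homotopy, but need
-- not be projective; the 2-kernel takes a projective cover `p` of `L` and pulls `src X ⟶ L` back
-- along it. Pips and roots are corrected in the same way. Test objects have projective lower term,
-- so their maps lift through the cover, and the ambiguity of the lift is absorbed by homotopies.
--
-- Both comparison arrows are equivalences for one reason. If the square `w : X ⟶ Y` is a pullback
-- and `d Y`, `f₀ w` are jointly epi, then `0 → X₁ → Y₁ ⊕ X₀ → Y₀ → 0` is exact. It splits because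
-- `Y₀` is projective, and the splitting supplies an inverse of `w` together with the homotopies
-- (`isEquivalenceArrow_of_isPullback`). A comparison arrow respects the structural maps only up to
-- homotopy, but a homotopy merely shears a pullback square into another one (`IsPullback.shear`).
-- So `isEquivalenceArrow_of_shear` leaves only a bicartesian square in `A` to be found. For the
-- coroot of the pip, dividing `src X` by the common kernel of `d X` and `f₁ f` turns the pushout
-- square of the 2-cokernel into a pullback. For the root of the copip, the 2-cokernel of the
-- 2-kernel is `L ⟶ tgt X`, because a pullback along an epi is a pushout; and `L` is still a
-- pullback over the image of `(d Y, f₀ f)` in `tgt Y`. Arbitrary choices of universal objects are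
-- reduced to these models by transport along equivalences and two-out-of-three.
--
-- Discrete means that `d` is mono: such an object is a projective presentation of its cokernel.
-- Codiscrete means that `d` is epi, hence split, and the object is determined by its kernel.

attribute [-instance] InducedBicategory.categoryStruct InducedBicategory.Hom.category
  StrictBicategory.category

attribute [-simp] InducedBicategory.bicategory_Hom

/-! ### Componentwise calculus of squares and homotopies. -/

namespace ProjArrow

variable {A : Type u} [Category.{v} A] [Preadditive A]

/-- The object of `ProjArrow A` given by an arrow with projective target. -/
abbrev of {X₁ X₀ : A} (d : X₁ ⟶ X₀) [h : Projective X₀] : ProjArrow A :=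
  (⟨⟨X₁, X₀, d⟩, h⟩ : {a : ArrowObj A // Projective a.X₀})

/-- The underlying arrow. -/
abbrev toArrow (X : ProjArrow A) : ArrowObj A := Subtype.val X

/-- The source of the underlying arrow. -/
abbrev src (X : ProjArrow A) : A := X.toArrow.X₁

/-- The target of the underlying arrow. -/
abbrev tgt (X : ProjArrow A) : A := X.toArrow.X₀

/-- The underlying arrow, as a morphism. -/
abbrev d (X : ProjArrow A) : src X ⟶ tgt X := X.toArrow.d

instance (X : ProjArrow A) : Projective (tgt X) := Subtype.property X

variable {X Y Z W : ProjArrow A}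

/-- The component of a morphism on sources. -/
def f₁ (f : X ⟶ Y) : src X ⟶ src Y := ArrowObj.Hom.f₁ f.hom

/-- The component of a morphism on targets. -/
def f₀ (f : X ⟶ Y) : tgt X ⟶ tgt Y := ArrowObj.Hom.f₀ f.hom


theorem comm (f : X ⟶ Y) : f₁ f ≫ d Y = d X ≫ f₀ f := ArrowObj.Hom.comm f.hom

theorem comm_assoc (f : X ⟶ Y) {T : A} (t : tgt Y ⟶ T) :
    f₁ f ≫ d Y ≫ t = d X ≫ f₀ f ≫ t := by
  rw [← Category.assoc, comm, Category.assoc]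

/-- The morphism given by a commutative square. -/
def homMk (g₁ : src X ⟶ src Y) (g₀ : tgt X ⟶ tgt Y) (w : g₁ ≫ d Y = d X ≫ g₀) : X ⟶ Y :=
  InducedBicategory.mkHom ⟨g₁, g₀, w⟩

@[simp] theorem f₁_homMk (g₁ : src X ⟶ src Y) (g₀ : tgt X ⟶ tgt Y) (w) :
    f₁ (homMk g₁ g₀ w) = g₁ := rfl

@[simp] theorem f₀_homMk (g₁ : src X ⟶ src Y) (g₀ : tgt X ⟶ tgt Y) (w) :
    f₀ (homMk g₁ g₀ w) = g₀ := rfl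

@[simp] theorem f₁_id : f₁ (𝟙 X) = 𝟙 (src X) := rfl

@[simp] theorem f₀_id : f₀ (𝟙 X) = 𝟙 (tgt X) := rfl

@[simp] theorem f₁_comp (f : X ⟶ Y) (g : Y ⟶ Z) : f₁ (f ≫ g) = f₁ f ≫ f₁ g := rfl

@[simp] theorem f₀_comp (f : X ⟶ Y) (g : Y ⟶ Z) : f₀ (f ≫ g) = f₀ f ≫ f₀ g := rfl

/-- The homotopy underlying a 2-arrow. -/
def h {f g : X ⟶ Y} (σ : f ⟶ g) : tgt X ⟶ src Y := ArrowObj.Hom₂.h σ.hom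

theorem f₁_sub {f g : X ⟶ Y} (σ : f ⟶ g) : f₁ f - f₁ g = d X ≫ h σ := ArrowObj.Hom₂.w₁ σ.hom

theorem f₀_sub {f g : X ⟶ Y} (σ : f ⟶ g) : f₀ f - f₀ g = h σ ≫ d Y := ArrowObj.Hom₂.w₀ σ.hom

theorem f₁_eq {f g : X ⟶ Y} (σ : f ⟶ g) : f₁ f = d X ≫ h σ + f₁ g := by
  rw [← f₁_sub]; abel

theorem f₀_eq {f g : X ⟶ Y} (σ : f ⟶ g) : f₀ f = h σ ≫ d Y + f₀ g := by
  rw [← f₀_sub]; abel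

/-- The 2-arrow given by a homotopy. -/
def mk₂ {f g : X ⟶ Y} (s : tgt X ⟶ src Y) (w₁ : f₁ f - f₁ g = d X ≫ s)
    (w₀ : f₀ f - f₀ g = s ≫ d Y) : f ⟶ g :=
  InducedBicategory.Hom₂.mk ⟨s, w₁, w₀⟩

@[simp] theorem h_mk₂ {f g : X ⟶ Y} (s : tgt X ⟶ src Y) (w₁) (w₀) :
    h (mk₂ (f := f) (g := g) s w₁ w₀) = s := rfl

theorem hom₂_ext {f g : X ⟶ Y} {σ τ : f ⟶ g} (e : h σ = h τ) : σ = τ :=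
  InducedBicategory.hom₂_ext (ArrowObj.hom₂_ext e)

theorem hom₂_ext_iff {f g : X ⟶ Y} {σ τ : f ⟶ g} : σ = τ ↔ h σ = h τ :=
  ⟨fun e => e ▸ rfl, hom₂_ext⟩

@[simp] theorem h_id (f : X ⟶ Y) : h (𝟙 f) = 0 := rfl

@[simp] theorem h_comp {f g k : X ⟶ Y} (σ : f ⟶ g) (τ : g ⟶ k) : h (σ ≫ τ) = h σ + h τ := rfl

@[simp] theorem h_whiskerLeft (f : X ⟶ Y) {g k : Y ⟶ Z} (σ : g ⟶ k) :
    h (f ◁ σ) = f₀ f ≫ h σ := rfl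

@[simp] theorem h_whiskerRight {f g : X ⟶ Y} (σ : f ⟶ g) (k : Y ⟶ Z) :
    h (σ ▷ k) = h σ ≫ f₁ k := rfl

@[simp] theorem h_associator_hom (f : X ⟶ Y) (g : Y ⟶ Z) (k : Z ⟶ W) :
    h (α_ f g k).hom = 0 := rfl

@[simp] theorem h_leftUnitor_hom (f : X ⟶ Y) : h (λ_ f).hom = 0 := rfl

@[simp] theorem h_rightUnitor_hom (f : X ⟶ Y) : h (ρ_ f).hom = 0 := rfl

@[simp] theorem h_inv {f g : X ⟶ Y} (σ : f ≅ g) : h σ.inv = - h σ.hom :=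
  eq_neg_of_add_eq_zero_left (by rw [← h_comp, σ.inv_hom_id, h_id])

/-- The invertible 2-arrow given by a homotopy. -/
@[simps hom]
def iso {f g : X ⟶ Y} (s : tgt X ⟶ src Y) (w₁ : f₁ f - f₁ g = d X ≫ s)
    (w₀ : f₀ f - f₀ g = s ≫ d Y) : f ≅ g where
  hom := mk₂ s w₁ w₀
  inv := mk₂ (-s) (by rw [Preadditive.comp_neg, ← w₁]; abel)
    (by rw [Preadditive.neg_comp, ← w₀]; abel)
  hom_inv_id := hom₂_ext (by simp)
  inv_hom_id := hom₂_ext (by simp)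

/-- All 2-arrows are invertible. -/
def isoOfHom {f g : X ⟶ Y} (σ : f ⟶ g) : f ≅ g := iso (h σ) (f₁_sub σ) (f₀_sub σ)

@[simp] theorem h_isoOfHom_hom {f g : X ⟶ Y} (σ : f ⟶ g) : h (isoOfHom σ).hom = h σ := rfl

theorem isLocallyGroupoid : IsLocallyGroupoid (ProjArrow A) := fun _ _ =>
  ⟨fun σ => ⟨(isoOfHom σ).inv, (isoOfHom σ).hom_inv_id, (isoOfHom σ).inv_hom_id⟩⟩

/-- Equal components give isomorphic morphisms. -/
def isoOfEq {f g : X ⟶ Y} (e₁ : f₁ f = f₁ g) (e₀ : f₀ f = f₀ g) : f ≅ g :=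
  iso 0 (by simp [e₁]) (by simp [e₀])

@[simp] theorem h_isoOfEq_hom {f g : X ⟶ Y} (e₁ : f₁ f = f₁ g) (e₀ : f₀ f = f₀ g) :
    h (isoOfEq e₁ e₀).hom = 0 := rfl

/-! ### The zero object, null-homotopies and loops. -/

section Zero

variable [HasZeroObject A]

open ZeroObject

instance : Projective (0 : A) := (isZero_zero A).projective

/-- The zero object of `ProjArrow A`. -/
noncomputable def zeroObject : GpdCat.ZeroObject (ProjArrow A) where
  obj := of (0 : (0 : A) ⟶ 0)
  toZ X := homMk 0 0 (by simp)
  fromZ X := homMk 0 0 (by simp)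
  toHom f g := mk₂ 0 ((isZero_zero A).eq_of_tgt _ _) ((isZero_zero A).eq_of_tgt _ _)
  fromHom f g := mk₂ 0 ((isZero_zero A).eq_of_src _ _) ((isZero_zero A).eq_of_src _ _)
  to_ext _ _ := hom₂_ext ((isZero_zero A).eq_of_tgt _ _)
  from_ext _ _ := hom₂_ext ((isZero_zero A).eq_of_src _ _)

@[simp] theorem f₁_zero : f₁ (zeroObject.zero X Y) = 0 := comp_zero (f := (0 : src X ⟶ 0))

@[simp] theorem f₀_zero : f₀ (zeroObject.zero X Y) = 0 := comp_zero (f := (0 : tgt X ⟶ 0))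

@[simp] theorem h_compZero (f : X ⟶ Y) : h (zeroObject.compZero f W) = 0 := by
  change (0 : tgt X ⟶ src W) + (show tgt X ⟶ src W from (0 : tgt X ⟶ 0) ≫ 0) = 0
  simp

@[simp] theorem h_zeroComp (f : X ⟶ Y) : h (zeroObject.zeroComp W f) = 0 := by
  change (0 : tgt W ⟶ src Y) + (show tgt W ⟶ src Y from (0 : tgt W ⟶ 0) ≫ 0) = 0
  simp

/-- A null-homotopy of a morphism. -/
noncomputable def mkNull {f : X ⟶ Y} (s : tgt X ⟶ src Y) (w₁ : f₁ f = d X ≫ s)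
    (w₀ : f₀ f = s ≫ d Y) : f ⟶ zeroObject.zero X Y :=
  mk₂ s (by simpa using w₁) (by simpa using w₀)

@[simp] theorem h_mkNull {f : X ⟶ Y} (s : tgt X ⟶ src Y) (w₁) (w₀) :
    h (mkNull (f := f) s w₁ w₀) = s := rfl

theorem f₁_eq_of_null {f : X ⟶ Y} (σ : f ⟶ zeroObject.zero X Y) : f₁ f = d X ≫ h σ := by
  simpa using f₁_sub σ

theorem f₀_eq_of_null {f : X ⟶ Y} (σ : f ⟶ zeroObject.zero X Y) : f₀ f = h σ ≫ d Y := by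
  simpa using f₀_sub σ

/-- A loop at the zero morphism. -/
noncomputable def mkLoop (s : tgt X ⟶ src Y) (w₁ : d X ≫ s = 0) (w₀ : s ≫ d Y = 0) :
    zeroObject.zero X Y ⟶ zeroObject.zero X Y :=
  mk₂ s (by simp [w₁]) (by simp [w₀])

@[simp] theorem h_mkLoop (s : tgt X ⟶ src Y) (w₁) (w₀) :
    h (mkLoop (X := X) (Y := Y) s w₁ w₀) = s := rfl

@[simp]
theorem d_h_loop (σ : zeroObject.zero X Y ⟶ zeroObject.zero X Y) : d X ≫ h σ = 0 := by
  rw [← f₁_sub]; simp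

@[simp]
theorem h_d_loop (σ : zeroObject.zero X Y ⟶ zeroObject.zero X Y) : h σ ≫ d Y = 0 := by
  rw [← f₀_sub]; simp

@[simp]
theorem h_d_loop_assoc (σ : zeroObject.zero X Y ⟶ zeroObject.zero X Y) {T : A} (t : tgt Y ⟶ T) :
    h σ ≫ d Y ≫ t = 0 := by
  rw [← Category.assoc, h_d_loop, zero_comp]

end Zero

end ProjArrow

/-! ### Two-out-of-three for equivalences. -/

namespace GpdCat

section

variable {C : Type u} [Bicategory.{w, v} C] {a b c : C}

theorem IsEquivalenceArrow.comp {f : a ⟶ b} {g : b ⟶ c} (hf : IsEquivalenceArrow f)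
    (hg : IsEquivalenceArrow g) : IsEquivalenceArrow (f ≫ g) := by
  obtain ⟨f', ⟨η⟩, ⟨ν⟩⟩ := hf
  obtain ⟨g', ⟨η'⟩, ⟨ν'⟩⟩ := hg
  refine ⟨g' ≫ f', ⟨?_⟩, ⟨?_⟩⟩
  · exact α_ _ _ _ ≪≫ whiskerLeftIso f ((α_ _ _ _).symm ≪≫ whiskerRightIso η' f' ≪≫ λ_ _) ≪≫ η
  · exact α_ _ _ _ ≪≫ whiskerLeftIso g' ((α_ _ _ _).symm ≪≫ whiskerRightIso ν g ≪≫ λ_ _) ≪≫ ν'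

theorem IsEquivalenceArrow.of_iso {f g : a ⟶ b} (hf : IsEquivalenceArrow f) (e : f ≅ g) :
    IsEquivalenceArrow g := by
  obtain ⟨f', ⟨η⟩, ⟨ν⟩⟩ := hf
  exact ⟨f', ⟨whiskerRightIso e.symm f' ≪≫ η⟩, ⟨whiskerLeftIso f' e.symm ≪≫ ν⟩⟩

theorem IsEquivalenceArrow.of_comp_left {f : a ⟶ b} {g : b ⟶ c} (hf : IsEquivalenceArrow f)
    (hfg : IsEquivalenceArrow (f ≫ g)) : IsEquivalenceArrow g := by
  obtain ⟨f', ⟨η⟩, ⟨ν⟩⟩ := hf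
  have hf' : IsEquivalenceArrow f' := ⟨f, ⟨ν⟩, ⟨η⟩⟩
  exact (hf'.comp hfg).of_iso ((α_ _ _ _).symm ≪≫ whiskerRightIso ν g ≪≫ λ_ _)

theorem IsEquivalenceArrow.of_comp_right {f : a ⟶ b} {g : b ⟶ c} (hg : IsEquivalenceArrow g)
    (hfg : IsEquivalenceArrow (f ≫ g)) : IsEquivalenceArrow f := by
  obtain ⟨g', ⟨η⟩, ⟨ν⟩⟩ := hg
  have hg' : IsEquivalenceArrow g' := ⟨g, ⟨ν⟩, ⟨η⟩⟩
  exact (hfg.comp hg').of_iso (α_ _ _ _ ≪≫ whiskerLeftIso f η ≪≫ ρ_ _)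

end

end GpdCat

/-! ### Whiskering with an equivalence. -/

namespace ProjArrow

variable {A : Type u} [Category.{v} A] [Preadditive A] {X Y Z W : ProjArrow A}

/-- Postcomposition with an equivalence is fully faithful. -/
theorem existsUnique_whiskerRight {e : Y ⟶ Z} (he : GpdCat.IsEquivalenceArrow e)
    {x y : X ⟶ Y} (χ : x ≫ e ⟶ y ≫ e) : ∃! ξ : x ⟶ y, ξ ▷ e = χ := by
  obtain ⟨g, ⟨η⟩, ⟨ν⟩⟩ := he
  have eg₁ : f₁ e ≫ f₁ g = d Y ≫ h η.hom + 𝟙 _ := f₁_eq η.hom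
  have eg₀ : f₀ e ≫ f₀ g = h η.hom ≫ d Y + 𝟙 _ := f₀_eq η.hom
  have ge₁ : f₁ g ≫ f₁ e = d Z ≫ h ν.hom + 𝟙 _ := f₁_eq ν.hom
  have χ₁ : f₁ x ≫ f₁ e - f₁ y ≫ f₁ e = d X ≫ h χ := f₁_sub χ
  have χ₀ : f₀ x ≫ f₀ e - f₀ y ≫ f₀ e = h χ ≫ d Z := f₀_sub χ
  -- The homotopy of the composite `x ≅ x ≫ e ≫ g ⟶ y ≫ e ≫ g ≅ y`: `χ` whiskered with `g` and
  -- conjugated by `η`.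
  let ξ : x ⟶ y := mk₂ (h χ ≫ f₁ g - (f₀ x - f₀ y) ≫ h η.hom)
    (by linear_combination (norm := (simp [← comm_assoc]; abel))
          χ₁ =≫ f₁ g - (f₁ x - f₁ y) ≫= eg₁)
    (by linear_combination (norm := (simp [comm]; abel)) χ₀ =≫ f₀ g - (f₀ x - f₀ y) ≫= eg₀)
  refine ⟨ξ, hom₂_ext ?_, fun ζ hζ => hom₂_ext ?_⟩
  -- By `ν`, whiskering with `g` is faithful as well, so the two homotopies may be compared after
  -- `f₁ g`.
  · have h₀ : h (ξ ▷ e) ≫ f₁ g = h χ ≫ f₁ g := by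
      linear_combination (norm := (simp [ξ]; abel)) h ξ ≫= eg₁ - f₀_sub ξ =≫ h η.hom
    linear_combination (norm := (simp; abel)) h₀ =≫ f₁ e - (h (ξ ▷ e) - h χ) ≫= ge₁ -
      f₀_sub χ =≫ h ν.hom + f₀_sub (ξ ▷ e) =≫ h ν.hom
  · have h₀ : h ζ ≫ f₁ e = h χ := by rw [← hζ]; rfl
    linear_combination (norm := (simp [ξ]; abel)) h₀ =≫ f₁ g - h ζ ≫= eg₁ + f₀_sub ζ =≫ h η.hom

/-- Precomposition with an equivalence is fully faithful. -/
theorem existsUnique_whiskerLeft {e : X ⟶ Y} (he : GpdCat.IsEquivalenceArrow e)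
    {x y : Y ⟶ Z} (χ : e ≫ x ⟶ e ≫ y) : ∃! ξ : x ⟶ y, e ◁ ξ = χ := by
  obtain ⟨g, ⟨η⟩, ⟨ν⟩⟩ := he
  have eg₀ : f₀ e ≫ f₀ g = h η.hom ≫ d X + 𝟙 _ := f₀_eq η.hom
  have ge₁ : f₁ g ≫ f₁ e = d Y ≫ h ν.hom + 𝟙 _ := f₁_eq ν.hom
  have ge₀ : f₀ g ≫ f₀ e = h ν.hom ≫ d Y + 𝟙 _ := f₀_eq ν.hom
  have χ₁ : f₁ e ≫ f₁ x - f₁ e ≫ f₁ y = d X ≫ h χ := f₁_sub χ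
  have χ₀ : f₀ e ≫ f₀ x - f₀ e ≫ f₀ y = h χ ≫ d Z := f₀_sub χ
  let ξ : x ⟶ y := mk₂ (f₀ g ≫ h χ - h ν.hom ≫ (f₁ x - f₁ y))
    (by linear_combination (norm := (simp [← comm_assoc]; abel))
          f₁ g ≫= χ₁ - ge₁ =≫ (f₁ x - f₁ y))
    (by linear_combination (norm := (simp [comm]; abel)) f₀ g ≫= χ₀ - ge₀ =≫ (f₀ x - f₀ y))
  refine ⟨ξ, hom₂_ext ?_, fun ζ hζ => hom₂_ext ?_⟩
  · have h₀ : f₀ g ≫ h (e ◁ ξ) = f₀ g ≫ h χ := by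
      linear_combination (norm := (simp [ξ]; abel)) ge₀ =≫ h ξ - h ν.hom ≫= f₁_sub ξ
    linear_combination (norm := (simp; abel)) f₀ e ≫= h₀ - eg₀ =≫ (h (e ◁ ξ) - h χ) -
      h η.hom ≫= f₁_sub χ + h η.hom ≫= f₁_sub (e ◁ ξ)
  · have h₀ : f₀ e ≫ h ζ = h χ := by rw [← hζ]; rfl
    linear_combination (norm := (simp [ξ]; abel)) f₀ g ≫= h₀ - ge₀ =≫ h ζ + h ν.hom ≫= f₁_sub ζ

end ProjArrow

/-! ### Bicartesian squares in abelian categories -/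

namespace CategoryTheory

theorem IsPullback.of_comp_mono {A : Type u} [Category.{v} A] {P X Y L M : A} {u : P ⟶ X}
    {a : P ⟶ Y} {q : X ⟶ L} {t : Y ⟶ L} (m : L ⟶ M) [Mono m]
    (hp : IsPullback u a (q ≫ m) (t ≫ m)) : IsPullback u a q t :=
  ⟨⟨by simpa only [← Category.assoc, cancel_mono] using hp.w⟩,
    ⟨PullbackCone.IsLimit.mk _
      (fun c => hp.lift c.fst c.snd (by rw [← Category.assoc, c.condition, Category.assoc]))
      (fun c => by simp) (fun c => by simp)
      (fun c n h₁ h₂ => hp.hom_ext (by simp [h₁]) (by simp [h₂]))⟩⟩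

section

variable {A : Type u} [Category.{v} A] [Abelian A] {P X Y L : A}
  {u : P ⟶ X} {a : P ⟶ Y} {q : X ⟶ L} {t : Y ⟶ L}

/-- In an abelian category, a pushout square whose first two arrows are jointly monic is a
pullback square. -/
theorem IsPushout.isPullback_of_mono (hp : IsPushout u a q t) [Mono (biprod.lift u (-a))] :
    IsPullback u a q t := by
  -- Any pushout makes `P ⟶ X ⊞ Y ⟶ L` exact in the middle, which gives existence of lifts; the mono
  -- hypothesis is needed only for their uniqueness.
  have key : ∀ {T : A} (x : T ⟶ X) (y : T ⟶ Y), x ≫ q = y ≫ t →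
      ∃ l : T ⟶ P, l ≫ biprod.lift u (-a) = biprod.lift x (-y) := by
    intro T x y h
    have hf : Mono hp.shortComplex.f := inferInstanceAs (Mono (biprod.lift u (-a)))
    have h' : biprod.lift x (-y) ≫ biprod.desc q t = 0 := by simp [h]
    exact ⟨hp.exact_shortComplex.lift (biprod.lift x (-y)) h',
      hp.exact_shortComplex.lift_f (biprod.lift x (-y)) h'⟩
  choose l hl using fun c : PullbackCone q t => key c.fst c.snd c.condition
  refine ⟨⟨hp.w⟩, ⟨PullbackCone.IsLimit.mk hp.w l (fun c => ?_) (fun c => ?_)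
    (fun c m h₁ h₂ => ?_)⟩⟩
  · simpa using hl c =≫ biprod.fst
  · simpa using hl c =≫ biprod.snd
  · rw [← cancel_mono (biprod.lift u (-a)), hl]
    ext <;> simp [h₁, h₂]

/-- In an abelian category, the pullback of an epimorphism is a pushout. -/
theorem IsPullback.isPushout_of_epi (hp : IsPullback u a q t) [Epi t] : IsPushout u a q t := by
  have hu : Epi u := by
    have := (hp.flip.isoPullback_hom_snd)
    rw [← this]; infer_instance
  -- The kernel of `t` lifts to `P` with zero component in `X`; hence a compatible `y` kills it and
  -- descends along the epi `t`.
  have key : ∀ {T : A} (y : Y ⟶ T) (x : X ⟶ T), u ≫ x = a ≫ y → kernel.ι t ≫ y = 0 := by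
    intro T y x h
    have : hp.lift 0 (kernel.ι t) (by simp) ≫ u ≫ x = 0 := by simp
    rw [h] at this
    simpa using this
  refine ⟨⟨hp.w⟩, ⟨PushoutCocone.IsColimit.mk hp.w
    (fun s => Abelian.epiDesc t s.inr (key s.inr s.inl s.condition))
    (fun s => ?_) (fun s => ?_) (fun s m h₁ h₂ => ?_)⟩⟩
  · rw [← cancel_epi u, ← Category.assoc, hp.w, Category.assoc, Abelian.comp_epiDesc, s.condition]
  · exact Abelian.comp_epiDesc _ _ _
  · rw [← cancel_epi t, h₂, Abelian.comp_epiDesc]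

/-- A bicartesian square may be sheared along a morphism `s`. -/
theorem IsPullback.shear (hp : IsPullback u a q t) (s : Y ⟶ X) :
    IsPullback (u + a ≫ s) a q (t + s ≫ q) := by
  refine ⟨⟨by simp [hp.w]⟩, ⟨PullbackCone.IsLimit.mk _
    (fun c => hp.lift (c.fst - c.snd ≫ s) c.snd (by simp [c.condition]))
    (fun c => by simp) (fun c => by simp) (fun c m h₁ h₂ => ?_)⟩⟩
  apply hp.hom_ext
  · simp [← h₁, ← h₂]
  · simp [← h₂]

end

end CategoryTheory

/-! ### Equivalences from bicartesian squares. -/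

namespace ProjArrow

variable {A : Type u} [Category.{v} A] [Abelian A] {X Y Z W : ProjArrow A}

/-- A bicartesian square is an equivalence. -/
theorem isEquivalenceArrow_of_isPullback (w : X ⟶ Y) (hp : IsPullback (f₁ w) (d X) (d Y) (f₀ w))
    (he : Epi (biprod.desc (d Y) (f₀ w))) : GpdCat.IsEquivalenceArrow w := by
  -- Projectivity of `tgt Y` splits the short exact sequence. The component `s₀` is the lower part
  -- of the inverse and `-s₁` is the homotopy from `g ≫ w` to the identity.
  obtain ⟨s, hs⟩ : ∃ s : tgt Y ⟶ src Y ⊞ tgt X, s ≫ biprod.desc (d Y) (f₀ w) = 𝟙 _ :=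
    ⟨Projective.factorThru (𝟙 _) _, Projective.factorThru_comp _ _⟩
  obtain ⟨s₁, s₀, hs⟩ : ∃ (s₁ : tgt Y ⟶ src Y) (s₀ : tgt Y ⟶ tgt X),
      s₁ ≫ d Y + s₀ ≫ f₀ w = 𝟙 _ :=
    ⟨s ≫ biprod.fst, s ≫ biprod.snd, by
      rw [← hs, biprod.desc_eq]; simp⟩
  let g : Y ⟶ X := homMk (hp.lift (𝟙 _ - d Y ≫ s₁) (d Y ≫ s₀)
    (by linear_combination (norm := (simp; abel)) - (d Y ≫= hs))) s₀ (by simp)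
  refine ⟨g, ⟨iso (hp.lift (- (f₀ w ≫ s₁)) (f₀ w ≫ s₀ - 𝟙 _)
      (by linear_combination (norm := simp) - (f₀ w ≫= hs))) ?_ ?_⟩,
    ⟨iso (- s₁) ?_ ?_⟩⟩
  · apply hp.hom_ext
    · simp [g, ← comm_assoc]
    · simp [g, ← comm_assoc]
  · simp [g]
  · simp [g]
  · linear_combination (norm := simp [g]) hs

/-- Let `w : X ⟶ Y` be an arrow such that `Y` is the pullback of an arrow `q` along an
epimorphism `p`. If the composite square from `X` to `q` is a sheared bicartesian square, then `w`
is an equivalence. -/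
theorem isEquivalenceArrow_of_shear (w : X ⟶ Y) {B L : A} {q : B ⟶ L} {r : src Y ⟶ B}
    {p : tgt Y ⟶ L} [Epi p] (hY : IsPullback r (d Y) q p) {u : src X ⟶ B} {t : tgt X ⟶ L}
    (hp : IsPullback u (d X) q t) (he : Epi (biprod.desc q t)) (s : tgt X ⟶ B)
    (h₁ : f₁ w ≫ r = u + d X ≫ s) (h₀ : f₀ w ≫ p = t + s ≫ q) :
    GpdCat.IsEquivalenceArrow w := by
  -- After shearing by `s`, the outer rectangle of `w` pasted with `hY` is a pullback, so the square
  -- of `w` is one too.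
  have hs := hp.shear s
  rw [← h₁, ← h₀] at hs
  refine isEquivalenceArrow_of_isPullback w (IsPullback.of_right hs (comm w) hY) ?_
  have hr : Epi r := by
    rw [← hY.flip.isoPullback_hom_snd]; infer_instance
  rw [Preadditive.epi_iff_cancel_zero]
  intro T z hz
  have hz₁ : d Y ≫ z = 0 := by simpa using biprod.inl ≫= hz
  have hz₂ : f₀ w ≫ z = 0 := by simpa using biprod.inr ≫= hz
  -- The kernel of `p` lifts to `src Y` through the pullback `hY`, so `z` descends to `L`, where
  -- joint epimorphy of `q` and `t` kills it.
  have hk : kernel.ι p ≫ z = 0 := by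
    have : hY.lift 0 (kernel.ι p) (by simp) ≫ d Y ≫ z = 0 := by simp [hz₁]
    simpa using this
  have hz' := Abelian.comp_epiDesc p z hk
  set z' := Abelian.epiDesc p z hk
  have hq : q ≫ z' = 0 := by
    rw [← cancel_epi r, ← Category.assoc, hY.w, Category.assoc, hz', hz₁, comp_zero]
  have ht : t ≫ z' = 0 := by
    have := h₀ =≫ z'
    simpa [hz', hz₂, hq] using this.symm
  have : z' = 0 := by
    rw [← cancel_epi (biprod.desc q t)]
    ext <;> simp [hq, ht]
  rw [← hz', this, comp_zero]

end ProjArrow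

/-! ### Components of the kernel and cokernel conditions for biproduct maps. -/

namespace CategoryTheory

variable {A : Type u} [Category.{v} A] [Abelian A] {X Y Z : A}

theorem comp_cokernel_π_desc_left (a : X ⟶ Z) (b : Y ⟶ Z) :
    a ≫ cokernel.π (biprod.desc a b) = 0 :=
  calc a ≫ cokernel.π (biprod.desc a b)
      = (biprod.inl ≫ biprod.desc a b) ≫ cokernel.π (biprod.desc a b) := by rw [biprod.inl_desc]
    _ = 0 := by rw [Category.assoc, cokernel.condition, comp_zero]

theorem comp_cokernel_π_desc_right (a : X ⟶ Z) (b : Y ⟶ Z) :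
    b ≫ cokernel.π (biprod.desc a b) = 0 :=
  calc b ≫ cokernel.π (biprod.desc a b)
      = (biprod.inr ≫ biprod.desc a b) ≫ cokernel.π (biprod.desc a b) := by rw [biprod.inr_desc]
    _ = 0 := by rw [Category.assoc, cokernel.condition, comp_zero]

theorem kernel_ι_lift_comp_left (a : X ⟶ Y) (b : X ⟶ Z) :
    kernel.ι (biprod.lift a b) ≫ a = 0 :=
  calc kernel.ι (biprod.lift a b) ≫ a
      = kernel.ι (biprod.lift a b) ≫ biprod.lift a b ≫ biprod.fst := by rw [biprod.lift_fst]
    _ = 0 := by rw [kernel.condition_assoc, zero_comp]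

theorem kernel_ι_lift_comp_right (a : X ⟶ Y) (b : X ⟶ Z) :
    kernel.ι (biprod.lift a b) ≫ b = 0 :=
  calc kernel.ι (biprod.lift a b) ≫ b
      = kernel.ι (biprod.lift a b) ≫ biprod.lift a b ≫ biprod.snd := by rw [biprod.lift_snd]
    _ = 0 := by rw [kernel.condition_assoc, zero_comp]

end CategoryTheory

open ZeroObject

/-! ### Explicit 2-kernels, 2-cokernels, pips, copips, roots and coroots. -/

namespace ProjArrow

variable {A : Type u} [Category.{v} A] [Abelian A] {X Y Z W : ProjArrow A}

/-- A homotopy pullback, covered by a projective, is a 2-kernel. -/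
theorem isKernel_of_isPullback {K : ProjArrow A} {f : X ⟶ Y} {k : K ⟶ X}
    {κ : k ≫ f ⟶ zeroObject.zero K Y} {L : A} {l₀ : L ⟶ tgt X} {l₁ : L ⟶ src Y}
    (hL : IsPullback l₀ l₁ (f₀ f) (d Y)) {δ : src X ⟶ L} (h₀ : δ ≫ l₀ = d X)
    (h₁ : δ ≫ l₁ = f₁ f) {p : tgt K ⟶ L} [Epi p] (hK : IsPullback (f₁ k) (d K) δ p)
    (hk : f₀ k = p ≫ l₀) (hκ : h κ = p ≫ l₁) :
    zeroObject.IsKernel f k κ where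
  exists_lift {T} x φ := by
    have hφ : f₀ x ≫ f₀ f = h φ ≫ d Y := f₀_eq_of_null φ
    -- The pair `(f₀ x, h φ)` is a map to `L`; it lifts through the cover because `tgt T` is
    -- projective.
    let t : tgt T ⟶ tgt K := Projective.factorThru (hL.lift (f₀ x) (h φ) hφ) p
    have ht : t ≫ p = hL.lift (f₀ x) (h φ) hφ := Projective.factorThru_comp _ _
    have ht₀ : t ≫ p ≫ l₀ = f₀ x := by rw [← Category.assoc, ht, hL.lift_fst]
    have ht₁ : t ≫ p ≫ l₁ = h φ := by rw [← Category.assoc, ht, hL.lift_snd]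
    have hs : f₁ x ≫ δ = (d T ≫ t) ≫ p := by
      apply hL.hom_ext
      · simp [h₀, ht₀, comm]
      · simpa [h₁, ht₁] using f₁_eq_of_null φ
    let x' : T ⟶ K := homMk (hK.lift (f₁ x) (d T ≫ t) hs) t (by simp)
    exact ⟨x', isoOfEq (by simp [x']) (by simp [x', hk, ht₀]), hom₂_ext (by simp [x', hκ, ht₁])⟩
  existsUnique_lift₂ {T} x y χ hχ := by
    have hχ' : h χ ≫ f₁ f + f₀ y ≫ h κ = f₀ x ≫ h κ := by
      simpa using hom₂_ext_iff.1 hχ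
    have χ₁ : f₁ x ≫ f₁ k - f₁ y ≫ f₁ k = d T ≫ h χ := f₁_sub χ
    have χ₀ : f₀ x ≫ f₀ k - f₀ y ≫ f₀ k = h χ ≫ d X := f₀_sub χ
    have hs : h χ ≫ δ = (f₀ x - f₀ y) ≫ p := by
      apply hL.hom_ext
      · simp [h₀, ← χ₀, hk]
      · simp only [Category.assoc, Preadditive.sub_comp, h₁, ← hκ, ← hχ']
        abel
    -- Both components are forced: whiskering with `k` must give `h χ`, and the boundary of the
    -- homotopy must be `f₀ x - f₀ y`.
    let ξ : x ⟶ y := mk₂ (hK.lift (h χ) (f₀ x - f₀ y) hs)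
      (by apply hK.hom_ext
          · simp [χ₁]
          · simp [comm]) (by simp)
    refine ⟨ξ, hom₂_ext (by simp [ξ]), fun ζ hζ => hom₂_ext (hK.hom_ext ?_ ?_)⟩
    · simp [ξ, ← hζ]
    · simp [ξ, ← f₀_sub]

/-- A pushout is a 2-cokernel. -/
theorem isCokernel_of_isPushout {Q : ProjArrow A} {f : X ⟶ Y} {q : Y ⟶ Q}
    {ξ : f ≫ q ⟶ zeroObject.zero X Q} (hQ : IsPushout (f₁ f) (d X) (f₁ q) (h ξ))
    [IsIso (f₀ q)] : zeroObject.IsCokernel f q ξ where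
  exists_desc {T} y φ := by
    have hξ : f₀ f ≫ f₀ q = h ξ ≫ d Q := f₀_eq_of_null ξ
    have hφ₀ : f₀ f ≫ f₀ y = h φ ≫ d T := f₀_eq_of_null φ
    have hφ₁ : f₁ f ≫ f₁ y = d X ≫ h φ := f₁_eq_of_null φ
    let y' : Q ⟶ T := homMk (hQ.desc (f₁ y) (h φ) hφ₁) (inv (f₀ q) ≫ f₀ y) (by
      apply hQ.hom_ext
      · simp [comm, comm_assoc]
      · rw [IsPushout.inr_desc_assoc, ← hφ₀, ← Category.assoc, ← hξ]
        simp)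
    exact ⟨y', isoOfEq (by simp [y']) (by simp [y']), hom₂_ext (by simp [y'])⟩
  existsUnique_desc₂ {T} x y χ hχ := by
    have hχ' : f₀ f ≫ h χ + h ξ ≫ f₁ y = h ξ ≫ f₁ x := by
      simpa using hom₂_ext_iff.1 hχ
    have hξ : f₀ f ≫ f₀ q = h ξ ≫ d Q := f₀_eq_of_null ξ
    have χ₁ : f₁ q ≫ f₁ x - f₁ q ≫ f₁ y = d Y ≫ h χ := f₁_sub χ
    have χ₀ : f₀ q ≫ f₀ x - f₀ q ≫ f₀ y = h χ ≫ d T := f₀_sub χ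
    let ζ : x ⟶ y := mk₂ (inv (f₀ q) ≫ h χ)
      (by apply hQ.hom_ext
          · simp [χ₁, comm_assoc]
          · have := hξ =≫ (inv (f₀ q) ≫ h χ)
            simp only [Category.assoc, IsIso.hom_inv_id_assoc] at this
            simp [← this, ← hχ']) (by simp [← χ₀])
    exact ⟨ζ, hom₂_ext (by simp [ζ]), fun ζ' hζ => hom₂_ext (by simp [ζ, ← hζ])⟩

theorem exists_isPushout (f : X ⟶ Y) : ∃ (Q : ProjArrow A) (q : Y ⟶ Q)
    (ξ : f ≫ q ⟶ zeroObject.zero X Q), IsIso (f₀ q) ∧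
      IsPushout (f₁ f) (d X) (f₁ q) (h ξ) := by
  let q : Y ⟶ of (pushout.desc (d Y) (f₀ f) (comm f)) :=
    homMk (pushout.inl (f₁ f) (d X)) (𝟙 _)
      ((pushout.inl_desc _ _ _).trans (Category.comp_id _).symm)
  let ξ : f ≫ q ⟶ zeroObject.zero X _ := mkNull (pushout.inr (f₁ f) (d X))
    (by simp [q, pushout.condition])
    ((Category.comp_id _).trans (pushout.inr_desc _ _ _).symm)
  have : IsIso (f₀ q) := inferInstanceAs (IsIso (𝟙 _))
  exact ⟨_, q, ξ, this, IsPushout.of_hasPushout _ _⟩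

/-- The object classifying the loops out of the target of `f` which are killed by `f`. -/
noncomputable abbrev copipObj (f : X ⟶ Y) : ProjArrow A :=
  of (0 : cokernel (biprod.desc (d Y) (f₀ f)) ⟶ 0)

/-- The universal loop out of the target of `f` which is killed by `f`. -/
noncomputable def copipLoop (f : X ⟶ Y) :
    zeroObject.zero Y (copipObj f) ⟶ zeroObject.zero Y (copipObj f) :=
  mkLoop (Y := copipObj f) (cokernel.π (biprod.desc (d Y) (f₀ f)))
    (comp_cokernel_π_desc_left _ _) comp_zero

theorem h_copipLoop (f : X ⟶ Y) :
    h (copipLoop f) = cokernel.π (biprod.desc (d Y) (f₀ f)) := rfl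

theorem whiskerLeft_copipLoop (f : X ⟶ Y) : f ◁ copipLoop f = 𝟙 _ :=
  hom₂_ext (comp_cokernel_π_desc_right _ _)

/-- A loop out of `Y` killed by `f` is a map on `tgt Y` vanishing on `d Y` and `f₀ f`, so it factors
through their common cokernel. The lower term 0 leaves room only for the zero homotopy, which makes
the hom-groupoids discrete. -/
theorem isCopip_copipLoop (f : X ⟶ Y) : zeroObject.IsCopip f (copipLoop f) := by
  let p := cokernel.π (biprod.desc (d Y) (f₀ f))
  have hR : IsZero (tgt (copipObj f)) := isZero_zero A
  refine ⟨whiskerLeft_copipLoop f, fun {T} σ hσ => ?_, fun {T} σ x y hx hy => ?_⟩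
  · have hσ' : f₀ f ≫ h σ = 0 := hom₂_ext_iff.1 hσ
    have hk : biprod.desc (d Y) (f₀ f) ≫ h σ = 0 := by ext <;> simp [hσ']
    let y : copipObj f ⟶ T := homMk (cokernel.desc _ _ hk) 0 (by
      rw [comp_zero, ← cancel_epi p]
      simp [p])
    exact ⟨y, hom₂_ext (by simp [h_copipLoop, y])⟩
  · have hx' : p ≫ f₁ x = h σ := by simpa [h_copipLoop] using hom₂_ext_iff.1 hx
    have hy' : p ≫ f₁ y = h σ := by simpa [h_copipLoop] using hom₂_ext_iff.1 hy
    have hxy : f₁ x = f₁ y := by rw [← cancel_epi p, hx', hy']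
    exact ⟨⟨⟨mk₂ 0 (by simp [hxy]) (hR.eq_of_src _ _)⟩, fun ζ => hom₂_ext (hR.eq_of_src _ _)⟩⟩

/-- The kernel of a loop, covered by a projective, is a root. -/
theorem isRoot_of_isPullback {R : ProjArrow A} {ρ : zeroObject.zero X Y ⟶ zeroObject.zero X Y}
    {r : R ⟶ X} {p : tgt R ⟶ kernel (h ρ)} [Epi p]
    (hR : IsPullback (f₁ r) (d R) (kernel.lift (h ρ) (d X) (d_h_loop ρ)) p)
    (hr : f₀ r = p ≫ kernel.ι (h ρ)) : zeroObject.IsRoot ρ r where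
  condition := hom₂_ext (by simp [hr])
  exists_lift {T} x hx := by
    have hx' : f₀ x ≫ h ρ = 0 := hom₂_ext_iff.1 hx
    let t : tgt T ⟶ tgt R := Projective.factorThru (kernel.lift _ _ hx') p
    have ht : t ≫ p = kernel.lift _ _ hx' := Projective.factorThru_comp _ _
    let x' : T ⟶ R := homMk (hR.lift (f₁ x) (d T ≫ t) (by
      rw [← cancel_mono (kernel.ι (h ρ))]
      simp [ht, comm])) t (by simp)
    exact ⟨x', ⟨isoOfEq (by simp [x']) (by simp [x', hr, reassoc_of% ht])⟩⟩
  existsUnique_lift₂ {T} x y χ := by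
    have χ₁ : f₁ x ≫ f₁ r - f₁ y ≫ f₁ r = d T ≫ h χ := f₁_sub χ
    have χ₀ : f₀ x ≫ f₀ r - f₀ y ≫ f₀ r = h χ ≫ d X := f₀_sub χ
    let ξ : x ⟶ y := mk₂ (hR.lift (h χ) (f₀ x - f₀ y) (by
        rw [← cancel_mono (kernel.ι (h ρ))]
        simp [← χ₀, hr]))
      (by apply hR.hom_ext
          · simp [χ₁]
          · simp [comm]) (by simp)
    refine ⟨ξ, hom₂_ext (by simp [ξ]), fun ζ hζ => hom₂_ext (hR.hom_ext ?_ ?_)⟩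
    · simp [ξ, ← hζ]
    · simp [ξ, ← f₀_sub]

/-- The cokernel of a loop is a coroot. -/
theorem isCoroot_of_cokernel {π : zeroObject.zero X Y ⟶ zeroObject.zero X Y} {Q : ProjArrow A}
    {c : Y ⟶ Q} [IsIso (f₀ c)] [Epi (f₁ c)] (w : h π ≫ f₁ c = 0)
    (hc : ∀ {T : A} (y : src Y ⟶ T), h π ≫ y = 0 → ∃ y', f₁ c ≫ y' = y) :
    zeroObject.IsCoroot π c where
  condition := hom₂_ext (by simpa using w)
  exists_desc {T} y hy := by
    obtain ⟨y₁, hy₁⟩ := hc (f₁ y) (hom₂_ext_iff.1 hy)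
    let y' : Q ⟶ T := homMk y₁ (inv (f₀ c) ≫ f₀ y) (by
      rw [← cancel_epi (f₁ c), reassoc_of% hy₁, comm, comm_assoc]
      simp)
    exact ⟨y', ⟨isoOfEq hy₁ (by simp [y'])⟩⟩
  existsUnique_desc₂ {T} x y χ := by
    have χ₁ : f₁ c ≫ f₁ x - f₁ c ≫ f₁ y = d Y ≫ h χ := f₁_sub χ
    have χ₀ : f₀ c ≫ f₀ x - f₀ c ≫ f₀ y = h χ ≫ d T := f₀_sub χ
    let ζ : x ⟶ y := mk₂ (inv (f₀ c) ≫ h χ)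
      (by rw [← cancel_epi (f₁ c)]; simp [χ₁, comm_assoc]) (by simp [← χ₀])
    exact ⟨ζ, hom₂_ext (by simp [ζ]), fun ζ' hζ => hom₂_ext (by simp [ζ, ← hζ])⟩

theorem exists_coroot (π : zeroObject.zero X Y ⟶ zeroObject.zero X Y) :
    ∃ (Q : ProjArrow A) (c : Y ⟶ Q), zeroObject.IsCoroot π c ∧ IsIso (f₀ c) ∧ Epi (f₁ c) ∧
      ∀ {T : A} (y : src Y ⟶ T), h π ≫ y = 0 → ∃ y', f₁ c ≫ y' = y := by
  let Q := of (cokernel.desc (h π) (d Y) (h_d_loop π))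
  let c : Y ⟶ Q := homMk (cokernel.π (h π)) (𝟙 _)
    ((cokernel.π_desc _ _ _).trans (Category.comp_id _).symm)
  have i₀ : IsIso (f₀ c) := inferInstanceAs (IsIso (𝟙 _))
  have i₁ : Epi (f₁ c) := inferInstanceAs (Epi (cokernel.π (h π)))
  have hc : ∀ {T : A} (y : src Y ⟶ T), h π ≫ y = 0 → ∃ y', f₁ c ≫ y' = y :=
    fun y hy => ⟨cokernel.desc _ y hy, cokernel.π_desc _ _ _⟩
  exact ⟨Q, c, isCoroot_of_cokernel (cokernel.condition _) hc, i₀, i₁, hc⟩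

variable [EnoughProjectives A]

theorem exists_isPullback_kernel (f : X ⟶ Y) : ∃ (K : ProjArrow A) (k : K ⟶ X)
    (κ : k ≫ f ⟶ zeroObject.zero K Y) (L : A) (l₀ : L ⟶ tgt X) (l₁ : L ⟶ src Y) (δ : src X ⟶ L)
    (p : tgt K ⟶ L), Epi p ∧ IsPullback l₀ l₁ (f₀ f) (d Y) ∧ IsPullback (f₁ k) (d K) δ p ∧
      δ ≫ l₀ = d X ∧ δ ≫ l₁ = f₁ f ∧ f₀ k = p ≫ l₀ ∧ h κ = p ≫ l₁ := by
  let δ : src X ⟶ pullback (f₀ f) (d Y) := pullback.lift (d X) (f₁ f) (comm f).symm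
  have h₀ : δ ≫ pullback.fst _ _ = d X := pullback.lift_fst _ _ _
  have h₁ : δ ≫ pullback.snd _ _ = f₁ f := pullback.lift_snd _ _ _
  let p := Projective.π (pullback (f₀ f) (d Y))
  have hp : pullback.fst δ p ≫ δ = pullback.snd δ p ≫ p := pullback.condition
  let k : of (pullback.snd δ p) ⟶ X := homMk (pullback.fst δ p) (p ≫ pullback.fst _ _)
    (by rw [← h₀, ← Category.assoc, hp, Category.assoc])
  let κ : k ≫ f ⟶ zeroObject.zero _ Y := mkNull (p ≫ pullback.snd _ _)
    (by simp only [f₁_comp, k, f₁_homMk, ← h₁, ← Category.assoc, hp])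
    (by simp [k, pullback.condition])
  exact ⟨_, k, κ, _, _, _, δ, p, inferInstanceAs (Epi (Projective.π _)),
    IsPullback.of_hasPullback _ _, IsPullback.of_hasPullback δ p, h₀, h₁, rfl, rfl⟩

/-- The object classifying the loops into the source of `f` which are killed by `f`. -/
noncomputable abbrev pipObj (f : X ⟶ Y) : ProjArrow A :=
  of (kernel.ι (Projective.π (kernel (biprod.lift (d X) (f₁ f)))))

/-- The universal loop into the source of `f` which is killed by `f`. -/
noncomputable def pipLoop (f : X ⟶ Y) :
    zeroObject.zero (pipObj f) X ⟶ zeroObject.zero (pipObj f) X :=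
  mkLoop (X := pipObj f) (Projective.π _ ≫ kernel.ι (biprod.lift (d X) (f₁ f)))
    (kernel.condition_assoc _ _ |>.trans zero_comp)
    (by rw [Category.assoc, kernel_ι_lift_comp_left, comp_zero])

theorem h_pipLoop (f : X ⟶ Y) :
    h (pipLoop f) = Projective.π _ ≫ kernel.ι (biprod.lift (d X) (f₁ f)) := rfl

theorem pipLoop_whiskerRight (f : X ⟶ Y) : pipLoop f ▷ f = 𝟙 _ :=
  hom₂_ext (by simp [h_pipLoop, kernel_ι_lift_comp_right])

/-- Loops into `X` killed by `f` are maps from a projective to the common kernel of `d X` and `f₁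
f`. The pip is the discrete object presenting this kernel. -/
theorem isPip_pipLoop (f : X ⟶ Y) : zeroObject.IsPip f (pipLoop f) := by
  let ι := kernel.ι (biprod.lift (d X) (f₁ f))
  let p := Projective.π (kernel (biprod.lift (d X) (f₁ f)))
  refine ⟨pipLoop_whiskerRight f, fun {T} σ hσ => ?_, fun {T} σ x y hx hy => ?_⟩
  · have hσ' : h σ ≫ f₁ f = 0 := hom₂_ext_iff.1 hσ
    have hk : h σ ≫ biprod.lift (d X) (f₁ f) = 0 := by ext <;> simp [hσ']
    let t : tgt T ⟶ Projective.over _ := Projective.factorThru (kernel.lift _ _ hk) p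
    have ht : t ≫ p = kernel.lift _ _ hk := Projective.factorThru_comp _ _
    have ht' : t ≫ p ≫ ι = h σ := by rw [← Category.assoc, ht]; exact kernel.lift_ι _ _ _
    have h₁ : (d T ≫ t) ≫ p = 0 := by rw [← cancel_mono ι]; simp [ht']
    exact ⟨homMk (kernel.lift p (d T ≫ t) h₁) t (kernel.lift_ι _ _ _),
      hom₂_ext (by simpa [h_pipLoop, p, ι] using ht')⟩
  · have hx' : f₀ x ≫ p ≫ ι = h σ := by simpa [h_pipLoop] using hom₂_ext_iff.1 hx
    have hy' : f₀ y ≫ p ≫ ι = h σ := by simpa [h_pipLoop] using hom₂_ext_iff.1 hy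
    have hs : (f₀ x - f₀ y) ≫ p = 0 := by rw [← cancel_mono ι]; simp [hx', hy']
    -- Two lifts through the cover differ by a map into its kernel, and that map is the only
    -- possible homotopy.
    have hl : kernel.lift p _ hs ≫ kernel.ι p = f₀ x - f₀ y := kernel.lift_ι _ _ _
    refine ⟨⟨⟨mk₂ (kernel.lift p _ hs) ?_ hl.symm⟩, fun ζ => hom₂_ext ?_⟩⟩
    · rw [← cancel_mono (kernel.ι p), Category.assoc, hl]
      have hx₁ : f₁ x ≫ kernel.ι p = d T ≫ f₀ x := comm x
      have hy₁ : f₁ y ≫ kernel.ι p = d T ≫ f₀ y := comm y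
      simp [hx₁, hy₁]
    · exact (cancel_mono (kernel.ι p)).1 ((f₀_sub ζ).symm.trans hl.symm)

theorem exists_isPullback_root (ρ : zeroObject.zero X Y ⟶ zeroObject.zero X Y) :
    ∃ (R : ProjArrow A) (r : R ⟶ X) (p : tgt R ⟶ kernel (h ρ)), Epi p ∧
      IsPullback (f₁ r) (d R) (kernel.lift (h ρ) (d X) (d_h_loop ρ)) p ∧
      f₀ r = p ≫ kernel.ι (h ρ) := by
  let δ := kernel.lift (h ρ) (d X) (d_h_loop ρ)
  let p := Projective.π (kernel (h ρ))
  have hδ : δ ≫ kernel.ι (h ρ) = d X := kernel.lift_ι _ _ _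
  let r : of (pullback.snd δ p) ⟶ X := homMk (pullback.fst δ p) (p ≫ kernel.ι _) (by
    rw [← hδ, ← Category.assoc, pullback.condition, Category.assoc])
  exact ⟨_, r, p, inferInstanceAs (Epi (Projective.π _)), IsPullback.of_hasPullback δ p, rfl⟩

end ProjArrow

namespace ProjArrow

variable {A : Type u} [Category.{v} A] [Abelian A] {X Y : ProjArrow A}

/-! ### Uniqueness of 2-kernels, 2-cokernels, roots and coroots -/

theorem nonempty_iso_of_isKernel {K T : ProjArrow A} {f : X ⟶ Y} {k : K ⟶ X}
    {κ : k ≫ f ⟶ zeroObject.zero K Y} (hk : zeroObject.IsKernel f k κ) {x y : T ⟶ K}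
    (χ : x ≫ k ⟶ y ≫ k) (hχ : h χ ≫ f₁ f + f₀ y ≫ h κ = f₀ x ≫ h κ) :
    ∃ ξ : x ≅ y, h ξ.hom ≫ f₁ k = h χ := by
  obtain ⟨ξ, hξ, -⟩ := hk.existsUnique_lift₂ x y χ (hom₂_ext (by simpa using hχ))
  exact ⟨isoOfHom ξ, hom₂_ext_iff.1 hξ⟩

theorem nonempty_iso_of_isCokernel {Q T : ProjArrow A} {f : X ⟶ Y} {q : Y ⟶ Q}
    {ξ : f ≫ q ⟶ zeroObject.zero X Q} (hq : zeroObject.IsCokernel f q ξ) {x y : Q ⟶ T}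
    (χ : q ≫ x ⟶ q ≫ y) (hχ : f₀ f ≫ h χ + h ξ ≫ f₁ y = h ξ ≫ f₁ x) :
    ∃ ζ : x ≅ y, f₀ q ≫ h ζ.hom = h χ := by
  obtain ⟨ζ, hζ, -⟩ := hq.existsUnique_desc₂ x y χ (hom₂_ext (by simpa using hχ))
  exact ⟨isoOfHom ζ, hom₂_ext_iff.1 hζ⟩

theorem exists_lift_of_isKernel {K T : ProjArrow A} {f : X ⟶ Y} {k : K ⟶ X}
    {κ : k ≫ f ⟶ zeroObject.zero K Y} (hk : zeroObject.IsKernel f k κ) (x : T ⟶ X)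
    (φ : x ≫ f ⟶ zeroObject.zero T Y) :
    ∃ (x' : T ⟶ K) (χ : x' ≫ k ≅ x), h χ.hom ≫ f₁ f + h φ = f₀ x' ≫ h κ := by
  obtain ⟨x', χ, hχ⟩ := hk.exists_lift x φ
  exact ⟨x', χ, by simpa using hom₂_ext_iff.1 hχ⟩

theorem exists_desc_of_isCokernel {Q T : ProjArrow A} {f : X ⟶ Y} {q : Y ⟶ Q}
    {ξ : f ≫ q ⟶ zeroObject.zero X Q} (hq : zeroObject.IsCokernel f q ξ) (y : Y ⟶ T)
    (φ : f ≫ y ⟶ zeroObject.zero X T) :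
    ∃ (y' : Q ⟶ T) (χ : q ≫ y' ≅ y), f₀ f ≫ h χ.hom + h φ = h ξ ≫ f₁ y' := by
  obtain ⟨y', χ, hχ⟩ := hq.exists_desc y φ
  exact ⟨y', χ, by simpa using hom₂_ext_iff.1 hχ⟩

theorem exists_equivalence_of_isKernel {K K' : ProjArrow A} {f : X ⟶ Y} {k : K ⟶ X}
    {κ : k ≫ f ⟶ zeroObject.zero K Y} {k' : K' ⟶ X} {κ' : k' ≫ f ⟶ zeroObject.zero K' Y}
    (hk : zeroObject.IsKernel f k κ) (hk' : zeroObject.IsKernel f k' κ') :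
    ∃ e : K ⟶ K', GpdCat.IsEquivalenceArrow e ∧
      ∃ χ : e ≫ k' ≅ k, h χ.hom ≫ f₁ f + h κ = f₀ e ≫ h κ' := by
  obtain ⟨e, χ, hχ⟩ := exists_lift_of_isKernel hk' k κ
  obtain ⟨g, ψ, hψ⟩ := exists_lift_of_isKernel hk k' κ'
  obtain ⟨η, -⟩ := nonempty_iso_of_isKernel hk (x := e ≫ g) (y := 𝟙 K)
    ((α_ e g k).hom ≫ e ◁ ψ.hom ≫ χ.hom ≫ (λ_ k).inv)
    (by linear_combination (norm := (simp; abel)) f₀ e ≫= hψ + hχ)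
  obtain ⟨ν, -⟩ := nonempty_iso_of_isKernel hk' (x := g ≫ e) (y := 𝟙 K')
    ((α_ g e k').hom ≫ g ◁ χ.hom ≫ ψ.hom ≫ (λ_ k').inv)
    (by linear_combination (norm := (simp; abel)) f₀ g ≫= hχ + hψ)
  exact ⟨e, ⟨g, ⟨η⟩, ⟨ν⟩⟩, χ, hχ⟩

theorem exists_equivalence_of_isCokernel {Q Q' : ProjArrow A} {f : X ⟶ Y} {q : Y ⟶ Q}
    {ξ : f ≫ q ⟶ zeroObject.zero X Q} {q' : Y ⟶ Q'} {ξ' : f ≫ q' ⟶ zeroObject.zero X Q'}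
    (hq : zeroObject.IsCokernel f q ξ) (hq' : zeroObject.IsCokernel f q' ξ') :
    ∃ e : Q ⟶ Q', GpdCat.IsEquivalenceArrow e ∧
      ∃ χ : q ≫ e ≅ q', f₀ f ≫ h χ.hom + h ξ' = h ξ ≫ f₁ e := by
  obtain ⟨e, χ, hχ⟩ := exists_desc_of_isCokernel hq q' ξ'
  obtain ⟨g, ψ, hψ⟩ := exists_desc_of_isCokernel hq' q ξ
  obtain ⟨η, -⟩ := nonempty_iso_of_isCokernel hq (x := e ≫ g) (y := 𝟙 Q)
    ((α_ q e g).inv ≫ χ.hom ▷ g ≫ ψ.hom ≫ (ρ_ q).inv)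
    (by linear_combination (norm := (simp; abel)) hψ + hχ =≫ f₁ g)
  obtain ⟨ν, -⟩ := nonempty_iso_of_isCokernel hq' (x := g ≫ e) (y := 𝟙 Q')
    ((α_ q' g e).inv ≫ ψ.hom ▷ e ≫ χ.hom ≫ (ρ_ q').inv)
    (by linear_combination (norm := (simp; abel)) hχ + hψ =≫ f₁ e)
  exact ⟨e, ⟨g, ⟨η⟩, ⟨ν⟩⟩, χ, hχ⟩

theorem exists_equivalence_of_isCoroot {Q Q' : ProjArrow A}
    {π : zeroObject.zero X Y ⟶ zeroObject.zero X Y} {c : Y ⟶ Q} {c' : Y ⟶ Q'}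
    (hc : zeroObject.IsCoroot π c) (hc' : zeroObject.IsCoroot π c') :
    ∃ e : Q ⟶ Q', GpdCat.IsEquivalenceArrow e ∧ Nonempty (c ≫ e ≅ c') := by
  obtain ⟨e, ⟨χ⟩⟩ := hc.exists_desc c' hc'.condition
  obtain ⟨g, ⟨ψ⟩⟩ := hc'.exists_desc c hc.condition
  obtain ⟨η, -⟩ := hc.existsUnique_desc₂ (e ≫ g) (𝟙 Q)
    ((α_ c e g).inv ≫ χ.hom ▷ g ≫ ψ.hom ≫ (ρ_ c).inv)
  obtain ⟨ν, -⟩ := hc'.existsUnique_desc₂ (g ≫ e) (𝟙 Q')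
    ((α_ c' g e).inv ≫ ψ.hom ▷ e ≫ χ.hom ≫ (ρ_ c').inv)
  exact ⟨e, ⟨g, ⟨isoOfHom η⟩, ⟨isoOfHom ν⟩⟩, ⟨χ⟩⟩

theorem exists_equivalence_of_isRoot {R R' : ProjArrow A}
    {ρ : zeroObject.zero X Y ⟶ zeroObject.zero X Y} {r : R ⟶ X} {r' : R' ⟶ X}
    (hr : zeroObject.IsRoot ρ r) (hr' : zeroObject.IsRoot ρ r') :
    ∃ e : R ⟶ R', GpdCat.IsEquivalenceArrow e ∧ Nonempty (e ≫ r' ≅ r) := by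
  obtain ⟨e, ⟨χ⟩⟩ := hr'.exists_lift r hr.condition
  obtain ⟨g, ⟨ψ⟩⟩ := hr.exists_lift r' hr'.condition
  obtain ⟨η, -⟩ := hr.existsUnique_lift₂ (e ≫ g) (𝟙 R)
    ((α_ e g r).hom ≫ e ◁ ψ.hom ≫ χ.hom ≫ (λ_ r).inv)
  obtain ⟨ν, -⟩ := hr'.existsUnique_lift₂ (g ≫ e) (𝟙 R')
    ((α_ g e r').hom ≫ g ◁ χ.hom ≫ ψ.hom ≫ (λ_ r').inv)
  exact ⟨e, ⟨g, ⟨isoOfHom η⟩, ⟨isoOfHom ν⟩⟩, ⟨χ⟩⟩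

/-! ### Invariance under equivalences -/

/-- Whiskering with `e` is fully faithful on 2-arrows, so null-homotopies of `x ≫ f` and of `x ≫ f'`
correspond. This lets the 2-cokernel `q` be replaced without changing the 2-kernel of `q`. -/
theorem isKernel_comp_equivalence {K Y' : ProjArrow A} {f : X ⟶ Y} {k : K ⟶ X}
    {κ : k ≫ f ⟶ zeroObject.zero K Y} (hk : zeroObject.IsKernel f k κ) {e : Y ⟶ Y'}
    (he : GpdCat.IsEquivalenceArrow e) {f' : X ⟶ Y'} (χ : f ≫ e ≅ f')
    {κ' : k ≫ f' ⟶ zeroObject.zero K Y'} (hκ : h κ' = h κ ≫ f₁ e - f₀ k ≫ h χ.hom) :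
    zeroObject.IsKernel f' k κ' where
  exists_lift {T} x φ := by
    obtain ⟨φ', hφ', -⟩ := existsUnique_whiskerRight he (x := x ≫ f) (y := zeroObject.zero T Y)
      ((α_ x f e).hom ≫ x ◁ χ.hom ≫ φ ≫ (isoOfHom (zeroObject.zeroComp T e)).inv)
    have hφ : h φ' ≫ f₁ e = f₀ x ≫ h χ.hom + h φ := by simpa using hom₂_ext_iff.1 hφ'
    obtain ⟨x', ψ, hψ⟩ := exists_lift_of_isKernel hk x φ'
    refine ⟨x', ψ, hom₂_ext ?_⟩
    linear_combination (norm := (simp [hκ]; abel)) hψ =≫ f₁ e - hφ - h ψ.hom ≫= f₁_sub χ.hom +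
      f₀_sub ψ.hom =≫ h χ.hom
  existsUnique_lift₂ {T} x y ψ hψ := by
    have hψ' : h ψ ≫ f₁ f' + f₀ y ≫ h κ' = f₀ x ≫ h κ' := by simpa using hom₂_ext_iff.1 hψ
    refine hk.existsUnique_lift₂ x y ψ ?_
    refine (existsUnique_whiskerRight he (x := (x ≫ k) ≫ f) (y := zeroObject.zero T Y) _).unique
      rfl (hom₂_ext ?_)
    linear_combination (norm := (simp [hκ]; abel)) - hψ' - h ψ ≫= f₁_sub χ.hom +
      f₀_sub ψ =≫ h χ.hom

theorem isCokernel_equivalence_comp {Q X' : ProjArrow A} {f : X ⟶ Y} {q : Y ⟶ Q}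
    {ξ : f ≫ q ⟶ zeroObject.zero X Q} (hq : zeroObject.IsCokernel f q ξ) {e : X' ⟶ X}
    (he : GpdCat.IsEquivalenceArrow e) {f' : X' ⟶ Y} (χ : e ≫ f ≅ f')
    {ξ' : f' ≫ q ⟶ zeroObject.zero X' Q} (hξ : h ξ' = f₀ e ≫ h ξ - h χ.hom ≫ f₁ q) :
    zeroObject.IsCokernel f' q ξ' where
  exists_desc {T} y φ := by
    obtain ⟨φ', hφ', -⟩ := existsUnique_whiskerLeft he (x := f ≫ y) (y := zeroObject.zero X T)
      ((α_ e f y).inv ≫ χ.hom ▷ y ≫ φ ≫ (isoOfHom (zeroObject.compZero e T)).inv)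
    have hφ : f₀ e ≫ h φ' = h χ.hom ≫ f₁ y + h φ := by simpa using hom₂_ext_iff.1 hφ'
    obtain ⟨y', ψ, hψ⟩ := exists_desc_of_isCokernel hq y φ'
    refine ⟨y', ψ, hom₂_ext ?_⟩
    linear_combination (norm := (simp [hξ]; abel)) f₀ e ≫= hψ - hφ - f₀_sub χ.hom =≫ h ψ.hom +
      h χ.hom ≫= f₁_sub ψ.hom
  existsUnique_desc₂ {T} x y ψ hψ := by
    have hψ' : f₀ f' ≫ h ψ + h ξ' ≫ f₁ y = h ξ' ≫ f₁ x := by simpa using hom₂_ext_iff.1 hψ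
    refine hq.existsUnique_desc₂ x y ψ ?_
    refine (existsUnique_whiskerLeft he (x := f ≫ q ≫ x) (y := zeroObject.zero X T) _).unique
      rfl (hom₂_ext ?_)
    linear_combination (norm := (simp [hξ]; abel)) - hψ' - f₀_sub χ.hom =≫ h ψ +
      h χ.hom ≫= f₁_sub ψ

end ProjArrow

namespace ProjArrow

variable {A : Type u} [Category.{v} A] [Abelian A] {X Y : ProjArrow A}

/-! ### The comparison arrow from the coroot of the pip to the kernel of the cokernel -/

theorem isCorootComparison_iff {Q K M : ProjArrow A} {f : X ⟶ Y} {q : Y ⟶ Q}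
    {ξ : f ≫ q ⟶ zeroObject.zero X Q} {k : K ⟶ Y} {κ : k ≫ q ⟶ zeroObject.zero K Q}
    {c : X ⟶ M} {w : M ⟶ K} :
    zeroObject.IsCorootComparison f ξ κ c w ↔
      ∃ θ : c ≫ w ≫ k ≅ f, h θ.hom ≫ f₁ q + h ξ = f₀ c ≫ f₀ w ≫ h κ := by
  simp [GpdCat.ZeroObject.IsCorootComparison, hom₂_ext_iff]

/-- The null-homotopy `ξ` factors `f` through the 2-kernel of `q`; the factor still kills the loop
`π`, so it descends to the coroot. -/
theorem exists_corootComparison {P M Q K : ProjArrow A} {f : X ⟶ Y}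
    {π : zeroObject.zero P X ⟶ zeroObject.zero P X} {c : X ⟶ M}
    {q : Y ⟶ Q} {ξ : f ≫ q ⟶ zeroObject.zero X Q} {k : K ⟶ Y}
    {κ : k ≫ q ⟶ zeroObject.zero K Q} (hπ : π ▷ f = 𝟙 _) (hc : zeroObject.IsCoroot π c)
    (hk : zeroObject.IsKernel q k κ) :
    ∃ w : M ⟶ K, zeroObject.IsCorootComparison f ξ κ c w := by
  obtain ⟨f', ψ, hψ⟩ := exists_lift_of_isKernel hk f ξ
  have hπf : h π ≫ f₁ f = 0 := hom₂_ext_iff.1 hπ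
  -- A 2-arrow into `K` is determined by its whiskering with `k`, and both sides become the identity
  -- there.
  have hf' : π ▷ f' = 𝟙 (zeroObject.zero P X ≫ f') := by
    refine (hk.existsUnique_lift₂ _ _ (𝟙 _) (by simp)).unique (hom₂_ext ?_) (by simp)
    linear_combination (norm := simp) h π ≫= f₁_sub ψ.hom + hπf
  obtain ⟨w, ⟨χ⟩⟩ := hc.exists_desc f' hf'
  refine ⟨w, isCorootComparison_iff.2 ⟨(α_ c w k).symm ≪≫ whiskerRightIso χ k ≪≫ ψ, ?_⟩⟩
  linear_combination (norm := (simp; abel)) hψ + h χ.hom ≫= f₁_sub κ - f₀_sub χ.hom =≫ h κ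

theorem isCorootComparison_cokernel {Q Q' K M : ProjArrow A} {f : X ⟶ Y} {q : Y ⟶ Q}
    {ξ : f ≫ q ⟶ zeroObject.zero X Q} {k : K ⟶ Y} {κ : k ≫ q ⟶ zeroObject.zero K Q}
    {c : X ⟶ M} {w : M ⟶ K} (hw : zeroObject.IsCorootComparison f ξ κ c w)
    {e : Q ⟶ Q'} {q' : Y ⟶ Q'} (χ : q ≫ e ≅ q') {ξ' : f ≫ q' ⟶ zeroObject.zero X Q'}
    {κ' : k ≫ q' ⟶ zeroObject.zero K Q'} (hχ : f₀ f ≫ h χ.hom + h ξ' = h ξ ≫ f₁ e)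
    (hκ : h κ' = h κ ≫ f₁ e - f₀ k ≫ h χ.hom) :
    zeroObject.IsCorootComparison f ξ' κ' c w := by
  obtain ⟨θ, hθ⟩ := isCorootComparison_iff.1 hw
  refine isCorootComparison_iff.2 ⟨θ, ?_⟩
  linear_combination (norm := (simp [hκ]; abel)) hθ =≫ f₁ e + hχ - h θ.hom ≫= f₁_sub χ.hom +
    f₀_sub θ.hom =≫ h χ.hom

theorem isCorootComparison_kernel {Q K K' M : ProjArrow A} {f : X ⟶ Y} {q : Y ⟶ Q}
    {ξ : f ≫ q ⟶ zeroObject.zero X Q} {k : K ⟶ Y} {κ : k ≫ q ⟶ zeroObject.zero K Q}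
    {c : X ⟶ M} {w : M ⟶ K} (hw : zeroObject.IsCorootComparison f ξ κ c w)
    {e : K ⟶ K'} {k' : K' ⟶ Y} {κ' : k' ≫ q ⟶ zeroObject.zero K' Q} (χ : e ≫ k' ≅ k)
    (hχ : h χ.hom ≫ f₁ q + h κ = f₀ e ≫ h κ') :
    zeroObject.IsCorootComparison f ξ κ' c (w ≫ e) := by
  obtain ⟨θ, hθ⟩ := isCorootComparison_iff.1 hw
  refine isCorootComparison_iff.2
    ⟨whiskerLeftIso c (α_ w e k' ≪≫ whiskerLeftIso w χ) ≪≫ θ, ?_⟩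
  linear_combination (norm := (simp; abel)) hθ + (f₀ c ≫ f₀ w) ≫= hχ

theorem isCorootComparison_coroot {Q K M M' : ProjArrow A} {f : X ⟶ Y} {q : Y ⟶ Q}
    {ξ : f ≫ q ⟶ zeroObject.zero X Q} {k : K ⟶ Y} {κ : k ≫ q ⟶ zeroObject.zero K Q}
    {c : X ⟶ M} {w : M ⟶ K} (hw : zeroObject.IsCorootComparison f ξ κ c w)
    {e : M' ⟶ M} {c' : X ⟶ M'} (χ : c' ≫ e ≅ c) :
    zeroObject.IsCorootComparison f ξ κ c' (e ≫ w) := by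
  obtain ⟨θ, hθ⟩ := isCorootComparison_iff.1 hw
  refine isCorootComparison_iff.2
    ⟨whiskerLeftIso c' (α_ e w k) ≪≫ (α_ c' e (w ≫ k)).symm ≪≫ whiskerRightIso χ (w ≫ k) ≪≫ θ,
      ?_⟩
  have hκ : f₁ k ≫ f₁ q = d K ≫ h κ := f₁_eq_of_null κ
  linear_combination (norm := (simp [comm_assoc]; abel)) hθ + (h χ.hom ≫ f₁ w) ≫= hκ -
    f₀_sub χ.hom =≫ (f₀ w ≫ h κ)

section

variable [EnoughProjectives A]

/-- When `f₀ q` is invertible the homotopy pullback `L` is `src Y` itself, so only a projective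
cover of `src Y` is needed. Pushout 2-cokernels are of this kind. -/
theorem exists_kernel_of_isIso (q : X ⟶ Y) [IsIso (f₀ q)] : ∃ (K : ProjArrow A) (k : K ⟶ X)
    (κ : k ≫ q ⟶ zeroObject.zero K Y), zeroObject.IsKernel q k κ ∧ Epi (h κ) ∧
      IsPullback (f₁ k) (d K) (f₁ q) (h κ) := by
  let p := Projective.π (src Y)
  have hp : pullback.fst (f₁ q) p ≫ f₁ q = pullback.snd (f₁ q) p ≫ p := pullback.condition
  have hL : IsPullback (d Y ≫ inv (f₀ q)) (𝟙 _) (f₀ q) (d Y) :=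
    IsPullback.of_vert_isIso ⟨by simp⟩
  let k : of (pullback.snd (f₁ q) p) ⟶ X := homMk (pullback.fst (f₁ q) p) (p ≫ d Y ≫ inv (f₀ q))
    (by rw [← Category.assoc, ← Category.assoc, IsIso.eq_comp_inv, Category.assoc, ← comm,
      ← Category.assoc, hp, Category.assoc])
  let κ : k ≫ q ⟶ zeroObject.zero _ Y := mkNull p hp (by simp [k])
  have hκ : IsPullback (f₁ k) (d _) (f₁ q) (h κ) := IsPullback.of_hasPullback (f₁ q) p
  exact ⟨_, k, κ, isKernel_of_isPullback (p := p) hL (by simp [comm_assoc]) (by simp) hκ rfl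
    (Category.comp_id _).symm, inferInstanceAs (Epi p), hκ⟩

/-- The canonical loop factors through `π` by universality, and its cover of the common kernel is
epi. So whatever kills an arbitrary pip kills the whole common kernel. -/
theorem comp_eq_zero_of_isPip {P : ProjArrow A} {f : X ⟶ Y}
    {π : zeroObject.zero P X ⟶ zeroObject.zero P X} (hπ : zeroObject.IsPip f π) {T : A}
    (t : src X ⟶ T) (ht : h π ≫ t = 0) : kernel.ι (biprod.lift (d X) (f₁ f)) ≫ t = 0 := by
  obtain ⟨x, hx⟩ := hπ.exists_lift (pipLoop f) (pipLoop_whiskerRight f)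
  have hx' : f₀ x ≫ h π = Projective.π _ ≫ kernel.ι (biprod.lift (d X) (f₁ f)) := by
    simpa [h_pipLoop] using hom₂_ext_iff.1 hx
  rw [← cancel_epi (Projective.π _), ← Category.assoc, ← hx', Category.assoc, ht]
  simp

theorem isEquivalenceArrow_of_isCorootComparison_of_isPushout {P M Q K : ProjArrow A} {f : X ⟶ Y}
    {π : zeroObject.zero P X ⟶ zeroObject.zero P X} {c : X ⟶ M} {q : Y ⟶ Q}
    {ξ : f ≫ q ⟶ zeroObject.zero X Q} {k : K ⟶ Y} {κ : k ≫ q ⟶ zeroObject.zero K Q}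
    (hπ : zeroObject.IsPip f π) [IsIso (f₀ c)] [Epi (f₁ c)] (hπc : h π ≫ f₁ c = 0)
    (hc : ∀ {T : A} (y : src X ⟶ T), h π ≫ y = 0 → ∃ y', f₁ c ≫ y' = y)
    (hQ : IsPushout (f₁ f) (d X) (f₁ q) (h ξ)) [Epi (h κ)]
    (hK : IsPullback (f₁ k) (d K) (f₁ q) (h κ)) {w : M ⟶ K}
    (hw : zeroObject.IsCorootComparison f ξ κ c w) : GpdCat.IsEquivalenceArrow w := by
  obtain ⟨θ, hθ⟩ := isCorootComparison_iff.1 hw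
  obtain ⟨u, hu⟩ := hc (f₁ f) (hom₂_ext_iff.1 hπ.condition)
  -- Both legs of the span defining the 2-cokernel factor through the epi `f₁ c`, up to the
  -- isomorphism `f₀ c`; cancelling it does not change the pushout.
  have hP : IsPushout u (d M) (f₁ q) (inv (f₀ c) ≫ h ξ) := by
    refine ⟨⟨?_⟩, ⟨PushoutCocone.IsColimit.mk _
      (fun s => hQ.desc s.inl (f₀ c ≫ s.inr) ?_) (fun s => by simp) (fun s => by simp)
      (fun s m h₁ h₂ => hQ.hom_ext (by simp [h₁]) (by simp [← h₂]))⟩⟩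
    · rw [← cancel_epi (f₁ c), reassoc_of% hu, comm_assoc]
      simp [hQ.w]
    · rw [← hu, Category.assoc, s.condition, comm_assoc]
  have : Mono (biprod.lift u (-d M)) := by
    rw [Preadditive.mono_iff_cancel_zero]
    intro T t ht
    have h₁ : t ≫ u = 0 := by simpa using ht =≫ biprod.fst
    have h₂ : t ≫ d M = 0 := by simpa using ht =≫ biprod.snd
    -- A lift of `t` to `src X` lies in the common kernel of `d X` and `f₁ f`, which `f₁ c` kills by
    -- `comp_eq_zero_of_isPip`.
    obtain ⟨T', p, _, t', ht'⟩ := surjective_up_to_refinements_of_epi (f₁ c) t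
    have h₃ : t' ≫ biprod.lift (d X) (f₁ f) = 0 := by
      ext
      · rw [← cancel_mono (f₀ c)]
        simp [← comm, ← reassoc_of% ht', h₂]
      · simp [← hu, ← reassoc_of% ht', h₁]
    rw [← cancel_epi p, ht', ← kernel.lift_ι _ _ h₃, Category.assoc,
      comp_eq_zero_of_isPip hπ _ hπc]
    simp
  have θ₁ : f₁ c ≫ f₁ w ≫ f₁ k - f₁ f = d X ≫ h θ.hom := f₁_sub θ.hom
  refine isEquivalenceArrow_of_shear w hK hP.isPullback_of_mono ?_ (inv (f₀ c) ≫ h θ.hom) ?_ ?_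
  · exact hP.epi_shortComplex_g
  · rw [← cancel_epi (f₁ c)]
    linear_combination (norm := (simp [comm_assoc, hu]; abel)) θ₁
  · rw [← cancel_epi (f₀ c)]
    linear_combination (norm := (simp; abel)) - hθ

/-- The 2-cokernel, 2-kernel and coroot are exchanged in turn for the explicit models; this composes
`w` with equivalences and keeps it a comparison arrow, so two-out-of-three applies. -/
theorem isEquivalenceArrow_of_isCorootComparison {P M Q K : ProjArrow A} {f : X ⟶ Y}
    {π : zeroObject.zero P X ⟶ zeroObject.zero P X} {c : X ⟶ M} {q : Y ⟶ Q}
    {ξ : f ≫ q ⟶ zeroObject.zero X Q} {k : K ⟶ Y} {κ : k ≫ q ⟶ zeroObject.zero K Q}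
    (hπ : zeroObject.IsPip f π) (hc : zeroObject.IsCoroot π c)
    (hq : zeroObject.IsCokernel f q ξ) (hk : zeroObject.IsKernel q k κ) {w : M ⟶ K}
    (hw : zeroObject.IsCorootComparison f ξ κ c w) : GpdCat.IsEquivalenceArrow w := by
  obtain ⟨Q', q', ξ', _, hQ⟩ := exists_isPushout f
  have hq' := isCokernel_of_isPushout hQ
  obtain ⟨e, he, χ, hχ⟩ := exists_equivalence_of_isCokernel hq hq'
  let κ' : k ≫ q' ⟶ zeroObject.zero K Q' :=
    k ◁ χ.inv ≫ (α_ k q e).inv ≫ κ ▷ e ≫ zeroObject.zeroComp K e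
  have hκ' : h κ' = h κ ≫ f₁ e - f₀ k ≫ h χ.hom := by
    simp [κ']; abel
  have hk' := isKernel_comp_equivalence hk he χ hκ'
  obtain ⟨K₂, k₂, κ₂, hk₂, _, hK₂⟩ := exists_kernel_of_isIso q'
  obtain ⟨e₂, he₂, χ₂, hχ₂⟩ := exists_equivalence_of_isKernel hk' hk₂
  obtain ⟨M₂, c₂, hc₂, _, _, hc₂'⟩ := exists_coroot π
  obtain ⟨e₃, he₃, ⟨χ₃⟩⟩ := exists_equivalence_of_isCoroot hc₂ hc
  have hw₂ := isCorootComparison_coroot (isCorootComparison_kernel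
    (isCorootComparison_cokernel hw χ hχ hκ') χ₂ hχ₂) χ₃
  exact he₂.of_comp_right (he₃.of_comp_left
    (isEquivalenceArrow_of_isCorootComparison_of_isPushout hπ (hom₂_ext_iff.1 hc₂.condition)
      hc₂' hQ hK₂ hw₂))

end

end ProjArrow

namespace ProjArrow

variable {A : Type u} [Category.{v} A] [Abelian A] {X Y : ProjArrow A}

/-! ### The comparison arrow from the cokernel of the kernel to the root of the copip -/

theorem isRootComparison_iff {K Q M : ProjArrow A} {f : X ⟶ Y} {k : K ⟶ X}
    {κ : k ≫ f ⟶ zeroObject.zero K Y} {q : X ⟶ Q} {ξ : k ≫ q ⟶ zeroObject.zero K Q}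
    {r : M ⟶ Y} {w : Q ⟶ M} :
    zeroObject.IsRootComparison f κ ξ r w ↔
      ∃ θ : (q ≫ w) ≫ r ≅ f, f₀ k ≫ h θ.hom + h κ = h ξ ≫ f₁ w ≫ f₁ r := by
  simp [GpdCat.ZeroObject.IsRootComparison, hom₂_ext_iff]

/-- Here `f` is first factored through the root. Since `r` is fully faithful on 2-arrows, `κ` lifts
to a null-homotopy of `k` followed by the factor, which then descends to the 2-cokernel. -/
theorem exists_rootComparison {R M Q K : ProjArrow A} {f : X ⟶ Y}
    {ρ : zeroObject.zero Y R ⟶ zeroObject.zero Y R} {r : M ⟶ Y} {k : K ⟶ X}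
    {κ : k ≫ f ⟶ zeroObject.zero K Y} {q : X ⟶ Q} {ξ : k ≫ q ⟶ zeroObject.zero K Q}
    (hρ : f ◁ ρ = 𝟙 _) (hr : zeroObject.IsRoot ρ r) (hq : zeroObject.IsCokernel k q ξ) :
    ∃ w : Q ⟶ M, zeroObject.IsRootComparison f κ ξ r w := by
  obtain ⟨f', ⟨ψ⟩⟩ := hr.exists_lift f hρ
  obtain ⟨φ, hφ, -⟩ := hr.existsUnique_lift₂ (k ≫ f') (zeroObject.zero K M)
    ((α_ k f' r).hom ≫ k ◁ ψ.hom ≫ κ ≫ (isoOfHom (zeroObject.zeroComp K r)).inv)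
  have hφ' : h φ ≫ f₁ r = f₀ k ≫ h ψ.hom + h κ := by simpa using hom₂_ext_iff.1 hφ
  obtain ⟨w, χ, hχ⟩ := exists_desc_of_isCokernel hq f' φ
  refine ⟨w, isRootComparison_iff.2 ⟨whiskerRightIso χ r ≪≫ ψ, ?_⟩⟩
  linear_combination (norm := (simp; abel)) hχ =≫ f₁ r - hφ'

theorem isRootComparison_kernel {K K' Q M : ProjArrow A} {f : X ⟶ Y} {k : K ⟶ X}
    {κ : k ≫ f ⟶ zeroObject.zero K Y} {q : X ⟶ Q} {ξ : k ≫ q ⟶ zeroObject.zero K Q}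
    {r : M ⟶ Y} {w : Q ⟶ M} (hw : zeroObject.IsRootComparison f κ ξ r w)
    {e : K' ⟶ K} {k' : K' ⟶ X} (χ : e ≫ k ≅ k') {κ' : k' ≫ f ⟶ zeroObject.zero K' Y}
    {ξ' : k' ≫ q ⟶ zeroObject.zero K' Q} (hχ : h χ.hom ≫ f₁ f + h κ' = f₀ e ≫ h κ)
    (hξ : h ξ' = f₀ e ≫ h ξ - h χ.hom ≫ f₁ q) :
    zeroObject.IsRootComparison f κ' ξ' r w := by
  obtain ⟨θ, hθ⟩ := isRootComparison_iff.1 hw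
  refine isRootComparison_iff.2 ⟨θ, ?_⟩
  linear_combination (norm := (simp [hξ]; abel)) f₀ e ≫= hθ + hχ - f₀_sub χ.hom =≫ h θ.hom +
    h χ.hom ≫= f₁_sub θ.hom

theorem isRootComparison_cokernel {K Q Q' M : ProjArrow A} {f : X ⟶ Y} {k : K ⟶ X}
    {κ : k ≫ f ⟶ zeroObject.zero K Y} {q : X ⟶ Q} {ξ : k ≫ q ⟶ zeroObject.zero K Q}
    {r : M ⟶ Y} {w : Q ⟶ M} (hw : zeroObject.IsRootComparison f κ ξ r w)
    {e : Q' ⟶ Q} {q' : X ⟶ Q'} {ξ' : k ≫ q' ⟶ zeroObject.zero K Q'} (χ : q' ≫ e ≅ q)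
    (hχ : f₀ k ≫ h χ.hom + h ξ = h ξ' ≫ f₁ e) :
    zeroObject.IsRootComparison f κ ξ' r (e ≫ w) := by
  obtain ⟨θ, hθ⟩ := isRootComparison_iff.1 hw
  refine isRootComparison_iff.2
    ⟨whiskerRightIso ((α_ q' e w).symm ≪≫ whiskerRightIso χ w) r ≪≫ θ, ?_⟩
  linear_combination (norm := (simp; abel)) hθ + hχ =≫ (f₁ w ≫ f₁ r)

theorem isRootComparison_root {K Q M M' : ProjArrow A} {f : X ⟶ Y} {k : K ⟶ X}
    {κ : k ≫ f ⟶ zeroObject.zero K Y} {q : X ⟶ Q} {ξ : k ≫ q ⟶ zeroObject.zero K Q}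
    {r : M ⟶ Y} {w : Q ⟶ M} (hw : zeroObject.IsRootComparison f κ ξ r w)
    {e : M ⟶ M'} {r' : M' ⟶ Y} (χ : e ≫ r' ≅ r) :
    zeroObject.IsRootComparison f κ ξ r' (w ≫ e) := by
  obtain ⟨θ, hθ⟩ := isRootComparison_iff.1 hw
  refine isRootComparison_iff.2
    ⟨whiskerRightIso (α_ q w e).symm r' ≪≫ α_ (q ≫ w) e r' ≪≫ whiskerLeftIso (q ≫ w) χ ≪≫ θ, ?_⟩
  have hξ : f₀ k ≫ f₀ q = h ξ ≫ d Q := f₀_eq_of_null ξ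
  linear_combination (norm := (simp [← comm_assoc]; abel)) hθ + hξ =≫ (f₀ w ≫ h χ.hom) -
    (h ξ ≫ f₁ w) ≫= f₁_sub χ.hom

/-- The canonical cokernel projection factors through `h ρ` by universality, so the kernel of `h ρ`
is no larger than the image of `(d Y, f₀ f)`. -/
theorem exact_of_isCopip {R : ProjArrow A} {f : X ⟶ Y}
    {ρ : zeroObject.zero Y R ⟶ zeroObject.zero Y R} (hρ : zeroObject.IsCopip f ρ)
    (w : biprod.desc (d Y) (f₀ f) ≫ h ρ = 0) :
    (ShortComplex.mk (biprod.desc (d Y) (f₀ f)) (h ρ) w).Exact := by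
  obtain ⟨y, hy⟩ := hρ.exists_desc (copipLoop f) (whiskerLeft_copipLoop f)
  have hy' : h ρ ≫ f₁ y = cokernel.π (biprod.desc (d Y) (f₀ f)) := by
    simpa [h_copipLoop] using hom₂_ext_iff.1 hy
  rw [ShortComplex.exact_iff_exact_up_to_refinements]
  intro T t ht
  have ht' : t ≫ h ρ = 0 := ht
  refine (ShortComplex.exact_cokernel (biprod.desc (d Y) (f₀ f))).exact_up_to_refinements t ?_
  change t ≫ cokernel.π _ = 0
  rw [← hy', ← Category.assoc, ht', zero_comp]

section

variable [EnoughProjectives A]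

theorem isEquivalenceArrow_of_isRootComparison {R M Q K : ProjArrow A} {f : X ⟶ Y}
    {ρ : zeroObject.zero Y R ⟶ zeroObject.zero Y R} {r : M ⟶ Y} {k : K ⟶ X}
    {κ : k ≫ f ⟶ zeroObject.zero K Y} {q : X ⟶ Q} {ξ : k ≫ q ⟶ zeroObject.zero K Q}
    (hρ : zeroObject.IsCopip f ρ) (hr : zeroObject.IsRoot ρ r)
    (hk : zeroObject.IsKernel f k κ) (hq : zeroObject.IsCokernel k q ξ) {w : Q ⟶ M}
    (hw : zeroObject.IsRootComparison f κ ξ r w) : GpdCat.IsEquivalenceArrow w := by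
  obtain ⟨K₁, k₁, κ₁, L, l₀, l₁, δ, p, _, hL, hK, hl₀, hl₁, hk₀, hκ⟩ := exists_isPullback_kernel f
  have hk₁ := isKernel_of_isPullback hL hl₀ hl₁ hK hk₀ hκ
  obtain ⟨e₁, he₁, χ₁, hχ₁⟩ := exists_equivalence_of_isKernel hk₁ hk
  let ξ₁ : k₁ ≫ q ⟶ zeroObject.zero K₁ Q :=
    χ₁.inv ▷ q ≫ (α_ e₁ k q).hom ≫ e₁ ◁ ξ ≫ zeroObject.compZero e₁ Q
  have hξ₁ : h ξ₁ = f₀ e₁ ≫ h ξ - h χ₁.hom ≫ f₁ q := by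
    simp [ξ₁]; abel
  have hq₁ := isCokernel_equivalence_comp hq he₁ χ₁ hξ₁
  let q₂ : X ⟶ of l₀ := homMk δ (𝟙 _) (by simp [hl₀])
  let ξ₂ : k₁ ≫ q₂ ⟶ zeroObject.zero K₁ (of l₀) := mkNull p hK.w (by simp [q₂, hk₀])
  have : IsIso (f₀ q₂) := inferInstanceAs (IsIso (𝟙 _))
  -- The pullback defining the 2-kernel is taken along the epi `p`, so it is a pushout, and `l₀ : L
  -- ⟶ tgt X` is the 2-cokernel.
  have hq₂ : zeroObject.IsCokernel k₁ q₂ ξ₂ := isCokernel_of_isPushout hK.isPushout_of_epi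
  obtain ⟨e₂, he₂, χ₂, hχ₂⟩ := exists_equivalence_of_isCokernel hq₂ hq₁
  obtain ⟨M₃, r₃, p₃, _, hM₃, hr₃⟩ := exists_isPullback_root ρ
  obtain ⟨e₃, he₃, ⟨χ₃⟩⟩ := exists_equivalence_of_isRoot hr (isRoot_of_isPullback hM₃ hr₃)
  have hw₃ := isRootComparison_root (isRootComparison_cokernel
    (isRootComparison_kernel hw χ₁ hχ₁ hξ₁) χ₂ hχ₂) χ₃
  refine he₂.of_comp_left (he₃.of_comp_right (?_ : GpdCat.IsEquivalenceArrow ((e₂ ≫ w) ≫ e₃)))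
  generalize (e₂ ≫ w) ≫ e₃ = v at hw₃ ⊢
  obtain ⟨θ, hθ⟩ := isRootComparison_iff.1 hw₃
  have θ₀ : f₀ v ≫ f₀ r₃ - f₀ f = h θ.hom ≫ d Y := by simpa [q₂] using f₀_sub θ.hom
  have hθ' : f₀ k₁ ≫ h θ.hom + h κ₁ = p ≫ f₁ v ≫ f₁ r₃ := hθ
  have hfρ : f₀ f ≫ h ρ = 0 := hom₂_ext_iff.1 hρ.condition
  -- Both legs land in the subobject `kernel (h ρ)` of `tgt Y`, over which `L` is still a pullback;
  -- exactness of the copip makes the corestricted legs jointly epi.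
  have hP : IsPullback l₁ l₀ (kernel.lift (h ρ) (d Y) (d_h_loop ρ))
      (kernel.lift (h ρ) (f₀ f) hfρ) :=
    .of_comp_mono (kernel.ι (h ρ)) (by simpa using hL.flip)
  have hdf : biprod.desc (d Y) (f₀ f) ≫ h ρ = 0 := by ext <;> simp [hfρ]
  have := (exact_of_isCopip hρ hdf).epi_kernelLift
  refine isEquivalenceArrow_of_shear v hM₃ hP ?_ (h (X := X) (Y := Y) θ.hom) ?_ ?_
  · convert! this
    ext <;> simp
  · rw [← cancel_epi p]
    linear_combination (norm := (simp [hk₀, hκ]; abel)) - hθ'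
  · rw [← cancel_mono (kernel.ι (h ρ))]
    linear_combination (norm := (simp [hr₃]; abel)) θ₀

end

end ProjArrow

namespace ProjArrow

variable {A : Type u} [Category.{v} A]

/-! ### Additivity -/

section

variable [Preadditive A] {X Y : ProjArrow A}

instance (X Y : ProjArrow A) : Add (X ⟶ Y) :=
  ⟨fun f g => homMk (f₁ f + f₁ g) (f₀ f + f₀ g) (by simp [comm])⟩

instance (X Y : ProjArrow A) : Neg (X ⟶ Y) :=
  ⟨fun f => homMk (- f₁ f) (- f₀ f) (by simp [comm])⟩

@[simp] theorem f₁_add (f g : X ⟶ Y) : f₁ (f + g) = f₁ f + f₁ g := rfl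

@[simp] theorem f₀_add (f g : X ⟶ Y) : f₀ (f + g) = f₀ f + f₀ g := rfl

@[simp] theorem f₁_neg (f : X ⟶ Y) : f₁ (-f) = - f₁ f := rfl

@[simp] theorem f₀_neg (f : X ⟶ Y) : f₀ (-f) = - f₀ f := rfl

end

variable [Abelian A]

theorem exists_biproduct (X Y : ProjArrow A) :
    ∃ (P : ProjArrow A) (p₁ : P ⟶ X) (p₂ : P ⟶ Y) (i₁ : X ⟶ P) (i₂ : Y ⟶ P),
      zeroObject.IsBiproduct p₁ p₂ i₁ i₂ := by
  let P : ProjArrow A := of (biprod.map (d X) (d Y))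
  let p₁ : P ⟶ X := homMk biprod.fst biprod.fst (biprod.map_fst _ _).symm
  let p₂ : P ⟶ Y := homMk biprod.snd biprod.snd (biprod.map_snd _ _).symm
  let i₁ : X ⟶ P := homMk biprod.inl biprod.inl (biprod.inl_map _ _)
  let i₂ : Y ⟶ P := homMk biprod.inr biprod.inr (biprod.inr_map _ _)
  have hpi₁ : f₁ p₁ ≫ f₁ i₁ + f₁ p₂ ≫ f₁ i₂ = 𝟙 _ := biprod.total
  have hpi₀ : f₀ p₁ ≫ f₀ i₁ + f₀ p₂ ≫ f₀ i₂ = 𝟙 _ := biprod.total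
  have h₁ : f₁ i₁ ≫ f₁ p₁ = 𝟙 _ := biprod.inl_fst
  have h₁' : f₀ i₁ ≫ f₀ p₁ = 𝟙 _ := biprod.inl_fst
  have h₂ : f₁ i₂ ≫ f₁ p₂ = 𝟙 _ := biprod.inr_snd
  have h₂' : f₀ i₂ ≫ f₀ p₂ = 𝟙 _ := biprod.inr_snd
  have h₃ : f₁ i₁ ≫ f₁ p₂ = 0 := biprod.inl_snd
  have h₃' : f₀ i₁ ≫ f₀ p₂ = 0 := biprod.inl_snd
  have h₄ : f₁ i₂ ≫ f₁ p₁ = 0 := biprod.inr_fst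
  have h₄' : f₀ i₂ ≫ f₀ p₁ = 0 := biprod.inr_fst
  refine ⟨P, p₁, p₂, i₁, i₂, ⟨⟨?_, ?_⟩, ⟨?_, ?_⟩, ⟨isoOfEq h₁ h₁'⟩,
    ⟨isoOfEq (h₃.trans f₁_zero.symm) (h₃'.trans f₀_zero.symm)⟩,
    ⟨isoOfEq (h₄.trans f₁_zero.symm) (h₄'.trans f₀_zero.symm)⟩, ⟨isoOfEq h₂ h₂'⟩⟩⟩
  -- From here on only the biproduct identities between the components are used.
  all_goals clear_value P p₁ p₂ i₁ i₂
  · intro T x₁ x₂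
    exact ⟨x₁ ≫ i₁ + x₂ ≫ i₂, ⟨isoOfEq (by simp [*]) (by simp [*])⟩,
      ⟨isoOfEq (by simp [*]) (by simp [*])⟩⟩
  · intro T x y σ₁ σ₂
    let σ : x ⟶ y := mk₂ (h σ₁ ≫ f₁ i₁ + h σ₂ ≫ f₁ i₂)
      (by linear_combination (norm := (simp; abel)) f₁_sub σ₁ =≫ f₁ i₁ + f₁_sub σ₂ =≫ f₁ i₂ -
            (f₁ x - f₁ y) ≫= hpi₁)
      (by linear_combination (norm := (simp [comm]; abel)) f₀_sub σ₁ =≫ f₀ i₁ +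
            f₀_sub σ₂ =≫ f₀ i₂ - (f₀ x - f₀ y) ≫= hpi₀)
    refine ⟨σ, ⟨hom₂_ext (by simp [σ, *]), hom₂_ext (by simp [σ, *])⟩, fun τ hτ => hom₂_ext ?_⟩
    have e : h τ = h τ ≫ (f₁ p₁ ≫ f₁ i₁ + f₁ p₂ ≫ f₁ i₂) := by rw [hpi₁, Category.comp_id]
    rw [e]
    simp [σ, ← hτ.1, ← hτ.2]
  · intro T x₁ x₂
    exact ⟨p₁ ≫ x₁ + p₂ ≫ x₂, ⟨isoOfEq (by simp [reassoc_of% h₁, reassoc_of% h₃])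
      (by simp [reassoc_of% h₁', reassoc_of% h₃'])⟩,
      ⟨isoOfEq (by simp [reassoc_of% h₂, reassoc_of% h₄])
        (by simp [reassoc_of% h₂', reassoc_of% h₄'])⟩⟩
  · intro T x y σ₁ σ₂
    let σ : x ⟶ y := mk₂ (f₀ p₁ ≫ h σ₁ + f₀ p₂ ≫ h σ₂)
      (by linear_combination (norm := (simp [← comm_assoc]; abel)) f₁ p₁ ≫= f₁_sub σ₁ +
            f₁ p₂ ≫= f₁_sub σ₂ - hpi₁ =≫ (f₁ x - f₁ y))
      (by linear_combination (norm := (simp; abel)) f₀ p₁ ≫= f₀_sub σ₁ +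
            f₀ p₂ ≫= f₀_sub σ₂ - hpi₀ =≫ (f₀ x - f₀ y))
    refine ⟨σ, ⟨hom₂_ext (by simp [σ, reassoc_of% h₁', reassoc_of% h₃']),
      hom₂_ext (by simp [σ, reassoc_of% h₂', reassoc_of% h₄'])⟩, fun τ hτ => hom₂_ext ?_⟩
    have e : h τ = (f₀ p₁ ≫ f₀ i₁ + f₀ p₂ ≫ f₀ i₂) ≫ h τ := by rw [hpi₀, Category.id_comp]
    rw [e]
    simp [σ, ← hτ.1, ← hτ.2]

theorem isAdditive : (zeroObject (A := A)).IsAdditive where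
  exists_biproduct := exists_biproduct
  exists_neg {X P} p₁ p₂ i₁ i₂ hP := by
    obtain ⟨α⟩ := hP.inl_fst
    obtain ⟨β⟩ := hP.inl_snd
    obtain ⟨γ⟩ := hP.inr_fst
    obtain ⟨δ⟩ := hP.inr_snd
    obtain ⟨s, ⟨σ⟩, ⟨τ⟩⟩ := hP.isCoproduct.exists_desc (𝟙 X) (𝟙 X)
    -- The arrow `(1, -1)` is `i₁ - i₂` in the strict componentwise addition, and homotopies
    -- subtract accordingly. This works for any biproduct, not only the direct sum.
    refine ⟨-𝟙 X, i₁ + -i₂, s, ⟨iso (h α.hom - h γ.hom) ?_ ?_⟩, ⟨iso (h β.hom - h δ.hom) ?_ ?_⟩,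
      ⟨σ⟩, ⟨τ⟩, ⟨iso (h σ.hom - h τ.hom) ?_ ?_⟩⟩
    · linear_combination (norm := (simp; abel)) f₁_sub α.hom - f₁_sub γ.hom
    · linear_combination (norm := (simp; abel)) f₀_sub α.hom - f₀_sub γ.hom
    · linear_combination (norm := (simp; abel)) f₁_sub β.hom - f₁_sub δ.hom
    · linear_combination (norm := (simp; abel)) f₀_sub β.hom - f₀_sub δ.hom
    · linear_combination (norm := (simp; abel)) f₁_sub σ.hom - f₁_sub τ.hom
    · linear_combination (norm := (simp; abel)) f₀_sub σ.hom - f₀_sub τ.hom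

theorem isTwoPuppeExact [EnoughProjectives A] : (zeroObject (A := A)).IsTwoPuppeExact where
  exists_kernel f := by
    obtain ⟨K, k, κ, L, l₀, l₁, δ, p, _, hL, hK, h₀, h₁, hk, hκ⟩ := exists_isPullback_kernel f
    exact ⟨K, k, κ, isKernel_of_isPullback hL h₀ h₁ hK hk hκ⟩
  exists_cokernel f := by
    obtain ⟨Q, q, ξ, _, hQ⟩ := exists_isPushout f
    exact ⟨Q, q, ξ, isCokernel_of_isPushout hQ⟩
  exists_pip f := ⟨_, _, isPip_pipLoop f⟩
  exists_copip f := ⟨_, _, isCopip_copipLoop f⟩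
  exists_root ρ := by
    obtain ⟨R, r, p, _, hR, hr⟩ := exists_isPullback_root ρ
    exact ⟨R, r, isRoot_of_isPullback hR hr⟩
  exists_coroot π := by
    obtain ⟨Q, c, hc, -⟩ := exists_coroot π
    exact ⟨Q, c, hc⟩
  coroot_comparison _ _ _ _ _ _ _ hπ hc hq hk :=
    ⟨exists_corootComparison hπ.condition hc hk,
      fun _ hw => isEquivalenceArrow_of_isCorootComparison hπ hc hq hk hw⟩
  root_comparison _ _ _ _ _ _ _ hρ hr hk hq :=
    ⟨exists_rootComparison hρ.condition hr hq,
      fun _ hw => isEquivalenceArrow_of_isRootComparison hρ hr hk hq hw⟩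

theorem isTwoAbelian [EnoughProjectives A] : GpdCat.IsTwoAbelian (ProjArrow A) :=
  ⟨isLocallyGroupoid, zeroObject, isAdditive, isTwoPuppeExact⟩

end ProjArrow

/-! ### Equivalence of a bicategory with a category. -/

namespace GpdCat

section

variable {C : Type u} [Bicategory.{w, v} C] {A : Type*} [Category A]

/-- The pseudofunctor to a category given by a functorial assignment on objects and arrows which
identifies arrows related by a 2-arrow. -/
def toLocallyDiscrete (obj : C → A) (map : ∀ {a b : C}, (a ⟶ b) → (obj a ⟶ obj b))
    (map_id : ∀ a : C, map (𝟙 a) = 𝟙 (obj a))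
    (map_comp : ∀ {a b c : C} (f : a ⟶ b) (g : b ⟶ c), map (f ≫ g) = map f ≫ map g)
    (map_eq : ∀ {a b : C} {f g : a ⟶ b}, (f ⟶ g) → map f = map g) :
    Pseudofunctor C (LocallyDiscrete A) where
  obj a := ⟨obj a⟩
  map f := (map f).toLoc
  map₂ σ := eqToHom (congrArg Quiver.Hom.toLoc (map_eq σ))
  map₂_id _ := Subsingleton.elim _ _
  map₂_comp _ _ := Subsingleton.elim _ _
  mapId a := eqToIso (congrArg Quiver.Hom.toLoc (map_id a))
  mapComp f g := eqToIso (congrArg Quiver.Hom.toLoc (map_comp f g))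
  map₂_whisker_left _ _ _ _ := Subsingleton.elim _ _
  map₂_whisker_right _ _ := Subsingleton.elim _ _
  map₂_associator _ _ _ := Subsingleton.elim _ _
  map₂_left_unitor _ := Subsingleton.elim _ _
  map₂_right_unitor _ := Subsingleton.elim _ _

/-- Parallel 2-arrows in the target are equal, so coherence is automatic; unique 2-arrows between
arrows with equal image give full faithfulness on hom-categories. -/
theorem equivalentToCategory_of_map (obj : C → A)
    (map : ∀ {a b : C}, (a ⟶ b) → (obj a ⟶ obj b)) (map_id : ∀ a : C, map (𝟙 a) = 𝟙 (obj a))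
    (map_comp : ∀ {a b c : C} (f : a ⟶ b) (g : b ⟶ c), map (f ≫ g) = map f ≫ map g)
    (map_eq : ∀ {a b : C} {f g : a ⟶ b}, (f ⟶ g) → map f = map g)
    (exists_obj : ∀ X : A, ∃ a : C, Nonempty (obj a ≅ X))
    (map_surjective : ∀ {a b : C} (g : obj a ⟶ obj b), ∃ f : a ⟶ b, map f = g)
    (unique_hom : ∀ {a b : C} {f g : a ⟶ b}, map f = map g → Nonempty (Unique (f ⟶ g))) :
    EquivalentToCategory C A := by
  refine ⟨toLocallyDiscrete obj map map_id map_comp map_eq, fun X => ?_, fun a b => ?_⟩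
  · obtain ⟨a, ⟨e⟩⟩ := exists_obj X.as
    exact ⟨a, e.hom.toLoc, e.inv.toLoc,
      ⟨eqToIso (congrArg Quiver.Hom.toLoc e.hom_inv_id)⟩,
      ⟨eqToIso (congrArg Quiver.Hom.toLoc e.inv_hom_id)⟩⟩
  · have hu : ∀ {f g : a ⟶ b} (_ : (map f).toLoc ⟶ (map g).toLoc), Nonempty (Unique (f ⟶ g)) :=
      fun σ => unique_hom (congrArg Discrete.as (LocallyDiscrete.eq_of_hom σ))
    refine { faithful := ⟨fun {f g} σ τ _ => ?_⟩, full := ⟨fun {f g} σ => ?_⟩,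
             essSurj := ⟨fun g => ?_⟩ }
    · obtain ⟨i⟩ := hu (eqToHom (congrArg Quiver.Hom.toLoc (map_eq σ)))
      exact (i.uniq σ).trans (i.uniq τ).symm
    · obtain ⟨i⟩ := hu σ
      exact ⟨i.default, Subsingleton.elim _ _⟩
    · obtain ⟨f, hf⟩ := map_surjective g.as
      exact ⟨f, ⟨eqToIso (Discrete.ext hf)⟩⟩

end

end GpdCat

open ZeroObject

namespace ProjArrow

variable {A : Type u} [Category.{v} A] [Abelian A]

/-! ### Discrete and codiscrete objects -/

/-- Loops from `0 ⟶ P` to `X` are exactly the maps from `P` to `src X` killed by `d X`. As `P` must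
be projective, a general test object is replaced by a cover. -/
theorem mono_d_of_isDiscreteObj [EnoughProjectives A] {X : ProjArrow A}
    (hX : GpdCat.IsDiscreteObj X) : Mono (d X) := by
  obtain ⟨Z, hZ⟩ := hX
  rw [Preadditive.mono_iff_cancel_zero]
  intro T t ht
  let P : ProjArrow A := of (0 : 0 ⟶ Projective.over T)
  let σ : zeroObject.zero P X ⟶ zeroObject.zero P X :=
    mkLoop (X := P) (Projective.π T ≫ t) zero_comp (by simp [ht])
  have hσ : Projective.π T ≫ t = 0 := hom₂_ext_iff.1 (hZ σ (𝟙 _) (Z.to_ext _ _))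
  rwa [← cancel_epi (Projective.π T), comp_zero]

theorem isDiscreteObj_of_mono {X : ProjArrow A} (hX : Mono (d X)) : GpdCat.IsDiscreteObj X :=
  ⟨zeroObject, fun _ _ _ σ τ _ => hom₂_ext (by rw [← cancel_mono (d X), ← f₀_sub, ← f₀_sub])⟩

theorem epi_d_of_isCodiscreteObj {X : ProjArrow A} (hX : GpdCat.IsCodiscreteObj X) :
    Epi (d X) := by
  obtain ⟨Z, hZ⟩ := hX
  rw [Preadditive.epi_iff_cancel_zero]
  intro T t ht
  let Q : ProjArrow A := of (0 : T ⟶ 0)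
  let σ : zeroObject.zero X Q ⟶ zeroObject.zero X Q := mkLoop (Y := Q) t ht comp_zero
  exact hom₂_ext_iff.1 (hZ σ (𝟙 _) (Z.from_ext _ _))

theorem isCodiscreteObj_of_epi {X : ProjArrow A} (hX : Epi (d X)) : GpdCat.IsCodiscreteObj X :=
  ⟨zeroObject, fun _ _ _ σ τ _ => hom₂_ext (by rw [← cancel_epi (d X), ← f₁_sub, ← f₁_sub])⟩

/-- The equivalence takes the cokernel of `d`. As for projective resolutions, maps of cokernels lift
to squares, uniquely up to homotopy, and a mono `d` makes the homotopy unique. -/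
theorem discrete_equivalentToCategory [EnoughProjectives A] :
    GpdCat.EquivalentToCategory
      (GpdCat.FullSub (fun a : ProjArrow A => GpdCat.IsDiscreteObj a)) A := by
  have hm : ∀ X : GpdCat.FullSub (fun a : ProjArrow A => GpdCat.IsDiscreteObj a), Mono (d X.1) :=
    fun X => mono_d_of_isDiscreteObj X.2
  refine GpdCat.equivalentToCategory_of_map (fun X => cokernel (d X.1))
    (fun f => cokernel.map _ _ (f₁ f.hom) (f₀ f.hom) (comm f.hom).symm)
    (fun X => ?_) (fun f g => ?_) (fun {X Y f g} σ => ?_) (fun X => ?_) (fun {X Y} g => ?_)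
    (fun {X Y f g} hfg => ?_)
  · rw [← cancel_epi (cokernel.π _)]
    exact (cokernel.π_desc _ _ _).trans ((Category.id_comp _).trans (Category.comp_id _).symm)
  · rw [← cancel_epi (cokernel.π _), cokernel.π_desc, cokernel.π_desc_assoc, Category.assoc,
      cokernel.π_desc]
    exact Category.assoc _ _ _
  · rw [← cancel_epi (cokernel.π _), cokernel.π_desc, cokernel.π_desc, f₀_eq σ.hom]
    simp
  · let p := Projective.π X
    refine ⟨⟨of (kernel.ι p), isDiscreteObj_of_mono (inferInstanceAs (Mono (kernel.ι p)))⟩, ⟨?_⟩⟩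
    exact IsColimit.coconePointUniqueUpToIso (cokernelIsCokernel (kernel.ι p))
      (Abelian.epiIsCokernelOfKernel _ (limit.isLimit (parallelPair p 0)))
  · have := hm Y
    let t : tgt X.1 ⟶ tgt Y.1 :=
      Projective.factorThru (cokernel.π (d X.1) ≫ g) (cokernel.π (d Y.1))
    have ht : t ≫ cokernel.π (d Y.1) = cokernel.π (d X.1) ≫ g := Projective.factorThru_comp _ _
    have hdt : (d X.1 ≫ t) ≫ cokernel.π (d Y.1) = 0 := by simp [ht]
    let s : src X.1 ⟶ src Y.1 := (ShortComplex.exact_cokernel (d Y.1)).lift _ hdt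
    have hs : s ≫ d Y.1 = d X.1 ≫ t := (ShortComplex.exact_cokernel (d Y.1)).lift_f _ hdt
    refine ⟨InducedBicategory.mkHom (homMk s t hs), ?_⟩
    rw [← cancel_epi (cokernel.π _), cokernel.π_desc]
    exact ht
  · have := hm Y
    rw [← cancel_epi (cokernel.π _), cokernel.π_desc, cokernel.π_desc, ← sub_eq_zero,
      ← Preadditive.sub_comp] at hfg
    let s : tgt X.1 ⟶ src Y.1 := (ShortComplex.exact_cokernel (d Y.1)).lift _ hfg
    have hs : s ≫ d Y.1 = f₀ f.hom - f₀ g.hom :=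
      (ShortComplex.exact_cokernel (d Y.1)).lift_f _ hfg
    refine ⟨⟨⟨⟨mk₂ s ?_ hs.symm⟩⟩, fun τ => InducedBicategory.hom₂_ext (hom₂_ext ?_)⟩⟩
    · rw [← cancel_mono (d Y.1), Category.assoc, hs]
      simp [comm]
    · rw [← cancel_mono (d Y.1), ← f₀_sub]
      exact hs.symm

/-- The equivalence takes the kernel of `d`, with `X ⟶ 0` as an object over a given `X`. -/
theorem codiscrete_equivalentToCategory :
    GpdCat.EquivalentToCategory
      (GpdCat.FullSub (fun a : ProjArrow A => GpdCat.IsCodiscreteObj a)) A := by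
  have he : ∀ X : GpdCat.FullSub (fun a : ProjArrow A => GpdCat.IsCodiscreteObj a), Epi (d X.1) :=
    fun X => epi_d_of_isCodiscreteObj X.2
  refine GpdCat.equivalentToCategory_of_map (fun X => kernel (d X.1))
    (fun f => kernel.map _ _ (f₁ f.hom) (f₀ f.hom) (comm f.hom).symm)
    (fun X => ?_) (fun f g => ?_) (fun {X Y f g} σ => ?_) (fun X => ?_) (fun {X Y} g => ?_)
    (fun {X Y f g} hfg => ?_)
  · rw [← cancel_mono (kernel.ι _)]
    exact (kernel.lift_ι _ _ _).trans ((Category.comp_id _).trans (Category.id_comp _).symm)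
  · rw [← cancel_mono (kernel.ι _), kernel.lift_ι, Category.assoc, kernel.lift_ι,
      kernel.lift_ι_assoc]
    exact (Category.assoc _ _ _).symm
  · rw [← cancel_mono (kernel.ι _), kernel.lift_ι, kernel.lift_ι, f₁_eq σ.hom]
    simp
  · refine ⟨⟨of (0 : X ⟶ 0), isCodiscreteObj_of_epi ?_⟩, ⟨kernelZeroIsoSource⟩⟩
    exact (isZero_zero A).epi _
  · have := he X
    -- An epi onto a projective splits, so the kernel has a retraction `r`, along which maps of
    -- kernels extend to squares with lower component 0.
    let s : tgt X.1 ⟶ src X.1 := Projective.factorThru (𝟙 _) (d X.1)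
    have hs : s ≫ d X.1 = 𝟙 _ := Projective.factorThru_comp _ _
    let r : src X.1 ⟶ kernel (d X.1) := kernel.lift _ (𝟙 _ - d X.1 ≫ s) (by simp [hs])
    have hr : r ≫ kernel.ι (d X.1) = 𝟙 _ - d X.1 ≫ s := kernel.lift_ι _ _ _
    have hr' : kernel.ι (d X.1) ≫ r = 𝟙 _ := by
      rw [← cancel_mono (kernel.ι _), Category.assoc, hr]
      simp
    refine ⟨InducedBicategory.mkHom (homMk (r ≫ g ≫ kernel.ι _) 0 (by simp)), ?_⟩
    rw [← cancel_mono (kernel.ι _), kernel.lift_ι]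
    change kernel.ι (d X.1) ≫ r ≫ g ≫ kernel.ι _ = _
    rw [← Category.assoc, hr', Category.id_comp]
  · have := he X
    rw [← cancel_mono (kernel.ι _), kernel.lift_ι, kernel.lift_ι, ← sub_eq_zero,
      ← Preadditive.comp_sub] at hfg
    -- The epi `d X` is the cokernel of its kernel, so a difference vanishing on the kernel factors
    -- uniquely through it as a homotopy.
    let s : tgt X.1 ⟶ src Y.1 := (ShortComplex.exact_kernel (d X.1)).desc _ hfg
    have hs : d X.1 ≫ s = f₁ f.hom - f₁ g.hom := (ShortComplex.exact_kernel (d X.1)).g_desc _ hfg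
    refine ⟨⟨⟨⟨mk₂ s hs.symm ?_⟩⟩, fun τ => InducedBicategory.hom₂_ext (hom₂_ext ?_)⟩⟩
    · rw [← cancel_epi (d X.1), ← Category.assoc, hs]
      simp [comm]
    · rw [← cancel_epi (d X.1), ← f₁_sub]
      exact hs.symm

end ProjArrow

theorem theorem3p1 (A : Type u) [Category.{v} A] [Abelian A] [EnoughProjectives A] :
    GpdCat.IsTwoAbelian (ProjArrow A) ∧
    GpdCat.EquivalentToCategory
      (GpdCat.FullSub (fun a : ProjArrow A => GpdCat.IsDiscreteObj a)) A ∧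
    GpdCat.EquivalentToCategory
      (GpdCat.FullSub (fun a : ProjArrow A => GpdCat.IsCodiscreteObj a)) A :=
  ⟨ProjArrow.isTwoAbelian, ProjArrow.discrete_equivalentToCategory,
    ProjArrow.codiscrete_equivalentToCategory⟩
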